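/- Let $(n_k)_{k}$ and $(d_k)_{k}$ be sequences of natural numbers with $n_k\to\infty$, $d_k\to\infty$ and $d_k/n_k\to y\in[0,1)$. For each $k$ let $x^{(k)}$ be a random vector in $\mathbb{R}^{d_k}$ with $\mathbb{E}[x^{(k)}]=0$ and covariance matrix $\Sigma_k=\mathrm{Cov}(x^{(k)})$, let $x^{(k)}_1,\dots,x^{(k)}_{n_k}$ be i.i.d. copies of $x^{(k)}$ (the rows of the data matrix), and let $\hat\Sigma_k=\frac{1}{n_k}\sum_{i=1}^{n_k}x^{(k)}_i(x^{(k)}_i)^T$. Write $\|\cdot\|$ for the spectral norm of a matrix and $$M_k=\sup_{|e|=1}\mathbb{E}\big[(e^Tx^{(k)})^4\big],\qquad \nu_k=\sup_{\|Q\|=1}\mathrm{Var}\big((x^{(k)})^TQx^{(k)}/d_k\big),\qquad F_{\Sigma_k}(u)=\frac{1}{d_k}\#\{i:\lambda_i(\Sigma_k)\le u\},$$ where $e$ ranges over the unit vectors of $\mathbb{R}^{d_k}$, $Q$ over the real $d_k\times d_k$ matrices of norm $1$, and $\lambda_i(\Sigma_k)$ are the eigenvalues of $\Sigma_k$ with multiplicity.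 Assume: 1. there is a function $F_\Sigma$ with $F_{\Sigma_k}(u)\to F_\Sigma(u)$ for Lebesgue-almost every $u\ge 0$; 2. $\sup_k M_k<\infty$ and $\nu_k\to 0$; 3. all eigenvalues of each $\Sigma_k$ lie in $[\sigma_{\min},\sigma_{\max}]$, where $\sigma_{\min}>0$ (possibly depending on $k$) and $\sigma_{\max}$ does not depend on $k$. Let $\lambda>0$ be fixed, let $d_\lambda^k=\mathrm{tr}\big(\Sigma_k(\Sigma_k+\lambda I)^{-1}\big)$ be the effective dimension of $\Sigma_k$, and assume $d_\lambda^k<n_k$ for every $k$. Then for every $k$ the random matrix $\big(\frac{1}{1-d_\lambda^k/n_k}\hat\Sigma_k+\lambda I\big)^{-1}$ is integrable, and $$\mathbb{E}\left[\left(\frac{1}{1-\frac{d_\lambda^k}{n_k}}\hat\Sigma_k+\lambda I\right)^{-1}\right]=(\Sigma_k+\lambda I)^{-1}+\Omega_0(k),\qquad\text{where } \|\Omega_0(k)\|\to 0\text{ as }k\to\infty.$$ -/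

import Mathlib

open MeasureTheory ProbabilityTheory Filter Topology
open scoped ENNReal NNReal Matrix
-- The norm of a matrix is the spectral norm (operator norm for the Euclidean norm).
open scoped Matrix.Norms.L2Operator

noncomputable section

namespace CovResolvent

/-- The covariance matrix `Cov(x)` of a random vector `x` in `ℝ^d` with law `P`. -/
def covMatrix {d : ℕ} (P : Measure (EuclideanSpace ℝ (Fin d))) : Matrix (Fin d) (Fin d) ℝ :=
  Matrix.of fun i j =>
    covariance (fun x : EuclideanSpace ℝ (Fin d) => x i)
      (fun x : EuclideanSpace ℝ (Fin d) => x j) P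

theorem covMatrix_isHermitian {d : ℕ} (P : Measure (EuclideanSpace ℝ (Fin d))) :
    (covMatrix P).IsHermitian := by
  ext i j
  simp [covMatrix, Matrix.conjTranspose_apply, covariance_comm]

/-- The empirical spectral distribution function of a real symmetric `d × d` matrix:
`u ↦ d⁻¹ #{i : λ_i ≤ u}`, the eigenvalues being counted with multiplicity. -/
def esd {d : ℕ} {A : Matrix (Fin d) (Fin d) ℝ} (hA : A.IsHermitian) (u : ℝ) : ℝ :=
  (Nat.card {i : Fin d // hA.eigenvalues i ≤ u} : ℝ) / (d : ℝ)

/-- The effective dimension `d_λ(Σ) = tr(Σ (Σ + λ I)⁻¹)`. -/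
def effDim {d : ℕ} (S : Matrix (Fin d) (Fin d) ℝ) (lam : ℝ) : ℝ :=
  (S * (S + lam • (1 : Matrix (Fin d) (Fin d) ℝ))⁻¹).trace

/-- `M = sup_{|e| = 1} E (eᵀ x)⁴`, for `x` with law `P`. -/
def fourthMoment {d : ℕ} (P : Measure (EuclideanSpace ℝ (Fin d))) : ℝ≥0∞ :=
  ⨆ (e : EuclideanSpace ℝ (Fin d)) (_ : ‖e‖ = 1), ∫⁻ x, ENNReal.ofReal (inner ℝ e x ^ 4) ∂P

/-- `ν = sup_{‖Ω‖ = 1} Var(xᵀ Ω x / d)`, for `x` with law `P`; here `‖Ω‖` is the spectral norm. -/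
def quadFormVar {d : ℕ} (P : Measure (EuclideanSpace ℝ (Fin d))) : ℝ≥0∞ :=
  ⨆ (Q : Matrix (Fin d) (Fin d) ℝ) (_ : ‖Q‖ = 1),
    evariance (fun x : EuclideanSpace ℝ (Fin d) => (x.ofLp ⬝ᵥ (Q *ᵥ x.ofLp)) / (d : ℝ)) P

/-- The empirical covariance `n⁻¹ ∑ i, x_i x_iᵀ` of `n` vectors in `ℝ^d`. -/
def empCov {n d : ℕ} (x : Fin n → EuclideanSpace ℝ (Fin d)) : Matrix (Fin d) (Fin d) ℝ :=
  (n : ℝ)⁻¹ • ∑ i, Matrix.vecMulVec (x i).ofLp (x i).ofLp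

/-- The resolvent `(A + λ I)⁻¹`. -/
def matResolvent {d : ℕ} (A : Matrix (Fin d) (Fin d) ℝ) (lam : ℝ) : Matrix (Fin d) (Fin d) ℝ :=
  (A + lam • (1 : Matrix (Fin d) (Fin d) ℝ))⁻¹

/-- A random matrix whose entries are all integrable. -/
def MatIntegrable {Ω : Type*} [MeasurableSpace Ω] {d : ℕ}
    (A : Ω → Matrix (Fin d) (Fin d) ℝ) (μ : Measure Ω) : Prop :=
  ∀ i j, Integrable (fun ω => A ω i j) μ

/-- The (entrywise) expectation of a random matrix. -/
def matExpect {Ω : Type*} [MeasurableSpace Ω] {d : ℕ}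
    (A : Ω → Matrix (Fin d) (Fin d) ℝ) (μ : Measure Ω) : Matrix (Fin d) (Fin d) ℝ :=
  Matrix.of fun i j => ∫ ω, A ω i j ∂μ

/-- The shrinkage estimator `((1 - d_λ(Σ) / n)⁻¹ Σ̂ + λ I)⁻¹` of `(Σ + λ I)⁻¹` formed from the
rows `x_1, …, x_n`. -/
def shrinkageEstimator {n d : ℕ} (S : Matrix (Fin d) (Fin d) ℝ) (lam : ℝ)
    (x : Fin n → EuclideanSpace ℝ (Fin d)) : Matrix (Fin d) (Fin d) ℝ :=
  matResolvent ((1 / (1 - effDim S lam / (n : ℝ))) • empCov x) lam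

end CovResolvent

end

open CovResolvent

/-! Write `g = c/n` with `c = 1/(1 - d_λ/n)`, so that the estimator is `R = (g ∑ x_i x_iᵀ + λ)⁻¹`,
and let `R_i` be the resolvent without row `i`. Taking expectations in `R (g ∑ x_i x_iᵀ + λ) = 1`
reduces everything to `E[R x_i x_iᵀ]`. By Sherman–Morrison, `R x_i = R_i x_i / (1 + g x_iᵀ R_i
x_i)`, and `R_i` is independent of `x_i`.

The scalar `g x_iᵀ R_i x_i` concentrates at `a = g E tr(Σ R)` (`integral_quad_sub_meanTrace_sq_le`):
`ν` controls the quadratic form given the other rows, a rank one change moves `tr(Σ R)` by O(1), and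
bounded differences give `tr(Σ R)` variance O(n), all to be multiplied by `g²`. Hence `E[R x_i x_iᵀ]
≈ (1 + a)⁻¹ E[R] Σ` in every pair of unit directions (`abs_integral_decouple_le`), and summing over
rows gives `E[R] (b Σ + λ) ≈ 1` with `b = c/(1 + a)` (`norm_matExpect_mul_sub_one_le`).

Inserting `E[R] ≈ (b Σ + λ)⁻¹` back into `a` gives `c ≈ b + g b tr(Σ (b Σ + λ)⁻¹)`. The definition
of `c` says exactly that `b = 1` solves this equation. The right side increases in `b` at rate at
least one, so `b ≈ 1` (`abs_sub_one_le_of_fixedPoint`), and the resolvent is Lipschitz in `b`. All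
errors are of order `√(ν + 1/n) + 1/n`, with constants depending only on `C`, `λ` and an upper bound
for `c` (`norm_matExpect_rowRes_sub_le`). -/

namespace CovResolvent

/-! ### Spectral norm, bilinear forms and traces of fixed matrices -/

section Deterministic

variable {d : ℕ}

/-- The Euclidean norm of a plain vector. -/
noncomputable abbrev eNorm (v : Fin d → ℝ) : ℝ := ‖WithLp.toLp 2 v‖

theorem eNorm_sq (v : Fin d → ℝ) : eNorm v ^ 2 = v ⬝ᵥ v := by
  rw [eNorm, EuclideanSpace.norm_sq_eq]
  simp [dotProduct, sq]

theorem abs_dotProduct_le (u v : Fin d → ℝ) : |u ⬝ᵥ v| ≤ eNorm u * eNorm v := by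
  have h := abs_real_inner_le_norm (WithLp.toLp 2 v) (WithLp.toLp 2 u)
  rw [EuclideanSpace.inner_eq_star_dotProduct] at h
  simpa [mul_comm] using h

theorem eNorm_mulVec_le (A : Matrix (Fin d) (Fin d) ℝ) (v : Fin d → ℝ) :
    eNorm (A *ᵥ v) ≤ ‖A‖ * eNorm v :=
  Matrix.l2_opNorm_mulVec A (WithLp.toLp 2 v)

theorem abs_bilin_le (A : Matrix (Fin d) (Fin d) ℝ) (u v : Fin d → ℝ) :
    |u ⬝ᵥ A *ᵥ v| ≤ ‖A‖ * eNorm u * eNorm v := by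
  refine (abs_dotProduct_le _ _).trans ?_
  calc eNorm u * eNorm (A *ᵥ v) ≤ eNorm u * (‖A‖ * eNorm v) := by
        gcongr; exact eNorm_mulVec_le A v
    _ = _ := by ring

theorem norm_le_of_eNorm_mulVec_le {A : Matrix (Fin d) (Fin d) ℝ} {K : ℝ} (hK : 0 ≤ K)
    (h : ∀ v : Fin d → ℝ, eNorm (A *ᵥ v) ≤ K * eNorm v) : ‖A‖ ≤ K := by
  rw [← Matrix.l2_opNorm_toEuclideanCLM]
  exact ContinuousLinearMap.opNorm_le_bound _ hK fun x => h x.ofLp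

theorem norm_le_of_abs_bilin_le {A : Matrix (Fin d) (Fin d) ℝ} {K : ℝ} (hK : 0 ≤ K)
    (h : ∀ u v : Fin d → ℝ, |u ⬝ᵥ A *ᵥ v| ≤ K * eNorm u * eNorm v) : ‖A‖ ≤ K := by
  refine norm_le_of_eNorm_mulVec_le hK fun v => ?_
  -- Testing against `u = A v` turns the bilinear bound into one for `‖A v‖²`.
  have h1 := h (A *ᵥ v) v
  rw [← eNorm_sq, abs_of_nonneg (sq_nonneg _)] at h1
  by_contra! hlt
  have h0 : 0 ≤ K * eNorm v := mul_nonneg hK (norm_nonneg _)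
  nlinarith [mul_pos (lt_of_le_of_lt h0 hlt) (sub_pos.2 hlt)]

/-- It suffices to bound a bilinear form on unit vectors. -/
theorem norm_le_of_abs_bilin_unit_le {A : Matrix (Fin d) (Fin d) ℝ} {K : ℝ} (hK : 0 ≤ K)
    (h : ∀ u v : Fin d → ℝ, eNorm u = 1 → eNorm v = 1 → |u ⬝ᵥ A *ᵥ v| ≤ K) : ‖A‖ ≤ K := by
  refine norm_le_of_abs_bilin_le hK fun u v => ?_
  rcases eq_or_ne u 0 with rfl | hu
  · simp [eNorm]
  rcases eq_or_ne v 0 with rfl | hv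
  · simp [eNorm]
  have key : ∀ w : Fin d → ℝ, w ≠ 0 → 0 < eNorm w := fun w hw => by
    rw [norm_pos_iff]; simpa using hw
  have unit : ∀ w : Fin d → ℝ, w ≠ 0 → eNorm ((eNorm w)⁻¹ • w) = 1 := fun w hw => by
    rw [eNorm, WithLp.toLp_smul, norm_smul, norm_inv, norm_norm, inv_mul_cancel₀ (key w hw).ne']
  have h1 := h _ _ (unit u hu) (unit v hv)
  rw [Matrix.mulVec_smul, dotProduct_smul, smul_dotProduct, smul_eq_mul, smul_eq_mul, abs_mul,
    abs_mul, abs_of_pos (inv_pos.2 (key u hu)), abs_of_pos (inv_pos.2 (key v hv))] at h1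
  have hu' := key u hu
  have hv' := key v hv
  calc |u ⬝ᵥ A *ᵥ v|
      = ((eNorm v)⁻¹ * ((eNorm u)⁻¹ * |u ⬝ᵥ A *ᵥ v|)) * eNorm u * eNorm v := by
        field_simp
    _ ≤ K * eNorm u * eNorm v := by gcongr

theorem abs_entry_le_norm (A : Matrix (Fin d) (Fin d) ℝ) (i j : Fin d) : |A i j| ≤ ‖A‖ := by
  have h := abs_bilin_le A (Pi.single i 1) (Pi.single j 1)
  simpa [eNorm] using h

theorem abs_trace_le (A : Matrix (Fin d) (Fin d) ℝ) : |A.trace| ≤ d * ‖A‖ := by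
  refine (Finset.abs_sum_le_sum_abs _ _).trans ?_
  refine (Finset.sum_le_sum fun i _ => abs_entry_le_norm A i i).trans ?_
  simp

theorem trace_mul_vecMulVec (A : Matrix (Fin d) (Fin d) ℝ) (u v : Fin d → ℝ) :
    (A * Matrix.vecMulVec u v).trace = v ⬝ᵥ A *ᵥ u := by
  rw [Matrix.mul_vecMulVec, Matrix.trace_vecMulVec, dotProduct_comm]

theorem vecMulVec_self_posSemidef (x : Fin d → ℝ) : (Matrix.vecMulVec x x).PosSemidef := by
  simpa using Matrix.posSemidef_vecMulVec_self_star x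

/-! ### Resolvents of positive semidefinite matrices and rank one updates -/

section Resolvent

variable {W : Matrix (Fin d) (Fin d) ℝ} {lam : ℝ}

theorem posDef_add_smul_one (hW : W.PosSemidef) (hl : 0 < lam) :
    (W + lam • (1 : Matrix (Fin d) (Fin d) ℝ)).PosDef :=
  Matrix.PosDef.posSemidef_add hW (Matrix.PosDef.one.smul hl)

theorem isUnit_det_add_smul_one (hW : W.PosSemidef) (hl : 0 < lam) :
    IsUnit (W + lam • (1 : Matrix (Fin d) (Fin d) ℝ)).det :=
  (Matrix.isUnit_iff_isUnit_det _).1 (posDef_add_smul_one hW hl).isUnit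

theorem matResolvent_mul_add (hW : W.PosSemidef) (hl : 0 < lam) :
    matResolvent W lam * (W + lam • (1 : Matrix (Fin d) (Fin d) ℝ)) = 1 :=
  Matrix.nonsing_inv_mul _ (isUnit_det_add_smul_one hW hl)

theorem add_mul_matResolvent (hW : W.PosSemidef) (hl : 0 < lam) :
    (W + lam • (1 : Matrix (Fin d) (Fin d) ℝ)) * matResolvent W lam = 1 :=
  Matrix.mul_nonsing_inv _ (isUnit_det_add_smul_one hW hl)

theorem matResolvent_posSemidef (hW : W.PosSemidef) (hl : 0 < lam) :
    (matResolvent W lam).PosSemidef :=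
  (posDef_add_smul_one hW hl).inv.posSemidef

theorem matResolvent_transpose (hW : W.PosSemidef) (hl : 0 < lam) :
    (matResolvent W lam)ᵀ = matResolvent W lam := by
  simpa [Matrix.IsHermitian] using (matResolvent_posSemidef hW hl).isHermitian

theorem quad_nonneg_of_posSemidef {A : Matrix (Fin d) (Fin d) ℝ} (hA : A.PosSemidef)
    (x : Fin d → ℝ) : 0 ≤ x ⬝ᵥ A *ᵥ x := by
  simpa using hA.dotProduct_mulVec_nonneg x

theorem dotProduct_matResolvent_mulVec (hW : W.PosSemidef) (hl : 0 < lam) (u v : Fin d → ℝ) :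
    u ⬝ᵥ matResolvent W lam *ᵥ v = (matResolvent W lam *ᵥ u) ⬝ᵥ v := by
  rw [Matrix.dotProduct_mulVec, ← Matrix.mulVec_transpose, matResolvent_transpose hW hl]

/-- With `y = R x` one has `x · y = y · W y + λ |y|²`, and the first term is nonnegative. This one
inequality yields both the norm bound `λ⁻¹` and the rank one trace bound. -/
theorem lam_mul_eNorm_sq_le (hW : W.PosSemidef) (hl : 0 < lam) (x : Fin d → ℝ) :
    lam * eNorm (matResolvent W lam *ᵥ x) ^ 2 ≤ x ⬝ᵥ matResolvent W lam *ᵥ x := by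
  set y := matResolvent W lam *ᵥ x with hy
  have hx : x = (W + lam • (1 : Matrix (Fin d) (Fin d) ℝ)) *ᵥ y := by
    rw [hy, Matrix.mulVec_mulVec, add_mul_matResolvent hW hl, Matrix.one_mulVec]
  have h1 : x ⬝ᵥ y = y ⬝ᵥ W *ᵥ y + lam * (y ⬝ᵥ y) := by
    rw [dotProduct_comm]
    conv_lhs => rw [hx]
    rw [Matrix.add_mulVec, dotProduct_add, Matrix.smul_mulVec, Matrix.one_mulVec, dotProduct_smul,
      smul_eq_mul]
  rw [h1, eNorm_sq]
  linarith [quad_nonneg_of_posSemidef hW y]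

theorem norm_matResolvent_le (hW : W.PosSemidef) (hl : 0 < lam) :
    ‖matResolvent W lam‖ ≤ lam⁻¹ := by
  refine norm_le_of_eNorm_mulVec_le (inv_nonneg.2 hl.le) fun v => ?_
  have h1 := lam_mul_eNorm_sq_le hW hl v
  have h2 := (le_abs_self _).trans (abs_dotProduct_le v (matResolvent W lam *ᵥ v))
  rw [inv_mul_eq_div, le_div_iff₀ hl]
  set t := eNorm (matResolvent W lam *ᵥ v)
  have ht : 0 ≤ t := norm_nonneg _
  rcases ht.eq_or_lt with h0 | h0
  · rw [← h0]; simp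
  · have : lam * t ^ 2 ≤ eNorm v * t := h1.trans h2
    nlinarith

/-- The Sherman–Morrison formula. Positivity of the resolvent keeps the denominator at least one, so
no invertibility assumption is needed. -/
theorem matResolvent_add_vecMulVec (hW : W.PosSemidef) (hl : 0 < lam) {g : ℝ} (hg : 0 ≤ g)
    (x : Fin d → ℝ) :
    matResolvent (W + g • Matrix.vecMulVec x x) lam =
      matResolvent W lam - (g / (1 + g * (x ⬝ᵥ matResolvent W lam *ᵥ x))) •
        Matrix.vecMulVec (matResolvent W lam *ᵥ x) (matResolvent W lam *ᵥ x) := by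
  set B := matResolvent W lam with hB
  set α := x ⬝ᵥ B *ᵥ x with hα
  have hα0 : 0 ≤ α := quad_nonneg_of_posSemidef (matResolvent_posSemidef hW hl) x
  have h1 : (1 + g * α) ≠ 0 := by positivity
  have e1 : (W + lam • (1 : Matrix (Fin d) (Fin d) ℝ)) * B = 1 := add_mul_matResolvent hW hl
  have e2 : (W + lam • (1 : Matrix (Fin d) (Fin d) ℝ)) *ᵥ (B *ᵥ x) = x := by
    rw [Matrix.mulVec_mulVec, e1, Matrix.one_mulVec]
  have e3 : x ᵥ* B = B *ᵥ x := by
    rw [← Matrix.mulVec_transpose, hB, matResolvent_transpose hW hl]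
  unfold matResolvent
  refine Matrix.inv_eq_right_inv ?_
  rw [add_right_comm, add_mul, mul_sub, e1, mul_smul_comm, Matrix.mul_vecMulVec, e2, smul_mul_assoc,
    mul_sub, Matrix.vecMulVec_mul, e3, mul_smul_comm, Matrix.vecMulVec_mul_vecMulVec, ← hα,
    Matrix.vecMulVec_smul, smul_sub, smul_smul, smul_smul]
  rw [sub_add_eq_add_sub, add_sub_assoc, ← sub_smul, add_eq_left, ← sub_smul]
  convert zero_smul ℝ _ using 2
  field_simp
  ring

theorem matResolvent_add_vecMulVec_mulVec (hW : W.PosSemidef) (hl : 0 < lam) {g : ℝ} (hg : 0 ≤ g)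
    (x v : Fin d → ℝ) :
    matResolvent (W + g • Matrix.vecMulVec x x) lam *ᵥ v =
      matResolvent W lam *ᵥ v - (g * (x ⬝ᵥ matResolvent W lam *ᵥ v) /
        (1 + g * (x ⬝ᵥ matResolvent W lam *ᵥ x))) • matResolvent W lam *ᵥ x := by
  rw [matResolvent_add_vecMulVec hW hl hg, Matrix.sub_mulVec, Matrix.smul_mulVec,
    Matrix.vecMulVec_mulVec, ← dotProduct_matResolvent_mulVec hW hl]
  rw [op_smul_eq_smul, smul_smul]
  congr 2
  ring

/-- Adding the row `x` only rescales the image of `x`; this is the source of the factor `(1 + a)⁻¹`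
in the limit equation. -/
theorem matResolvent_add_vecMulVec_mulVec_self (hW : W.PosSemidef) (hl : 0 < lam) {g : ℝ}
    (hg : 0 ≤ g) (x : Fin d → ℝ) :
    matResolvent (W + g • Matrix.vecMulVec x x) lam *ᵥ x =
      (1 + g * (x ⬝ᵥ matResolvent W lam *ᵥ x))⁻¹ • matResolvent W lam *ᵥ x := by
  have hα0 : 0 ≤ x ⬝ᵥ matResolvent W lam *ᵥ x :=
    quad_nonneg_of_posSemidef (matResolvent_posSemidef hW hl) x
  rw [matResolvent_add_vecMulVec_mulVec hW hl hg]
  nth_rw 1 [← one_smul ℝ (matResolvent W lam *ᵥ x)]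
  rw [← sub_smul]
  congr 1
  have h1 : (1 + g * (x ⬝ᵥ matResolvent W lam *ᵥ x)) ≠ 0 := by positivity
  field_simp
  ring

/-- A rank one perturbation changes `tr (S R)` by a bounded amount. -/
theorem trace_mul_matResolvent_sub (hW : W.PosSemidef) (hl : 0 < lam) {g : ℝ}
    (hg : 0 ≤ g) (x : Fin d → ℝ) {S : Matrix (Fin d) (Fin d) ℝ} (hS : S.PosSemidef) {s : ℝ}
    (hs : ‖S‖ ≤ s) :
    (S * matResolvent W lam).trace - (S * matResolvent (W + g • Matrix.vecMulVec x x) lam).trace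
      ∈ Set.Icc 0 (s / lam) := by
  have hα0 : 0 ≤ x ⬝ᵥ matResolvent W lam *ᵥ x :=
    quad_nonneg_of_posSemidef (matResolvent_posSemidef hW hl) x
  have h1 : 0 < 1 + g * (x ⬝ᵥ matResolvent W lam *ᵥ x) := by positivity
  rw [matResolvent_add_vecMulVec hW hl hg, mul_sub, Matrix.trace_sub, sub_sub_cancel,
    mul_smul_comm, Matrix.trace_smul, trace_mul_vecMulVec, smul_eq_mul]
  have h2 := lam_mul_eNorm_sq_le hW hl x
  have h3 := (le_abs_self _).trans (abs_bilin_le S (matResolvent W lam *ᵥ x)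
    (matResolvent W lam *ᵥ x))
  set y := matResolvent W lam *ᵥ x
  have h4 : y ⬝ᵥ S *ᵥ y ≤ s * eNorm y ^ 2 := by
    rw [sq, ← mul_assoc]
    exact h3.trans (by gcongr)
  have hs0 : 0 ≤ s := (norm_nonneg _).trans hs
  refine ⟨mul_nonneg (by positivity) (quad_nonneg_of_posSemidef hS y), ?_⟩
  rw [div_mul_eq_mul_div, div_le_div_iff₀ h1 hl]
  -- The size of `x` cancels: `λ |y|²` is at most `x · y`, which also sits in the denominator, and
  -- `gα/(1 + gα) ≤ 1`.
  calc g * (y ⬝ᵥ S *ᵥ y) * lam ≤ g * (s * eNorm y ^ 2) * lam := by gcongr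
    _ = s * g * (lam * eNorm y ^ 2) := by ring
    _ ≤ s * g * (x ⬝ᵥ y) := by gcongr
    _ ≤ s * (1 + g * (x ⬝ᵥ y)) := by nlinarith

/-- The resolvent of a continuous family of positive semidefinite matrices is continuous. -/
theorem continuous_matResolvent {T : Type*} [TopologicalSpace T]
    {A : T → Matrix (Fin d) (Fin d) ℝ} (hA : Continuous A) (hpos : ∀ t, (A t).PosSemidef)
    (hl : 0 < lam) : Continuous fun t => matResolvent (A t) lam := by
  have hc : Continuous fun t => A t + lam • (1 : Matrix (Fin d) (Fin d) ℝ) :=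
    hA.add continuous_const
  -- Cramer's rule: the adjugate is polynomial in the entries and the determinant never vanishes.
  have : (fun t => matResolvent (A t) lam) = fun t =>
      ((A t + lam • (1 : Matrix (Fin d) (Fin d) ℝ)).det)⁻¹ •
        (A t + lam • (1 : Matrix (Fin d) (Fin d) ℝ)).adjugate := by
    ext1 t
    rw [matResolvent, Matrix.inv_def, Ring.inverse_eq_inv']
  rw [this]
  exact (hc.matrix_det.inv₀ fun t => (isUnit_det_add_smul_one (hpos t) hl).ne_zero).smul
    hc.matrix_adjugate

end Resolvent

end Deterministic

/-! ### The fixed point equation for the scalar `b` and its stability -/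

section Monotone

variable {d : ℕ} {S : Matrix (Fin d) (Fin d) ℝ} {lam : ℝ}

theorem commute_matResolvent (hS : S.PosSemidef) (hl : 0 < lam) {b : ℝ} (hb : 0 ≤ b) :
    S * matResolvent (b • S) lam = matResolvent (b • S) lam * S := by
  have h1 := matResolvent_mul_add (hS.smul hb) hl
  have h2 := add_mul_matResolvent (hS.smul hb) hl
  set B := matResolvent (b • S) lam
  set N := b • S + lam • (1 : Matrix (Fin d) (Fin d) ℝ) with hN
  have hc : S * N = N * S := by
    rw [hN]; simp [mul_add, add_mul]
  calc S * B = (B * N) * (S * B) := by rw [h1, one_mul]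
    _ = B * (N * S) * B := by simp only [mul_assoc]
    _ = B * S * (N * B) := by rw [← hc]; simp only [mul_assoc]
    _ = B * S := by rw [h2, mul_one]

/-- The resolvent identity along the ray `b • S`. -/
theorem matResolvent_smul_sub (hS : S.PosSemidef) (hl : 0 < lam) {b : ℝ} (hb : 0 ≤ b) :
    matResolvent S lam - matResolvent (b • S) lam =
      (b - 1) • (matResolvent S lam * S * matResolvent (b • S) lam) := by
  have h1 := matResolvent_mul_add hS hl
  have h2 := add_mul_matResolvent (hS.smul hb) hl
  set B := matResolvent (b • S) lam
  set K := matResolvent S lam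
  calc K - B = K * ((b • S + lam • 1) * B) - (K * (S + lam • 1)) * B := by
        rw [h1, h2, mul_one, one_mul]
    _ = _ := by
        simp only [mul_add, add_mul, sub_smul, one_smul, smul_mul_assoc, mul_smul_comm, mul_assoc,
          one_mul]
        abel

/-- The product is itself positive semidefinite. Inserting `(S + λ) K = 1` and `B (b S + λ) = 1`
exhibits `K S` and then `K S B` as congruences of sums of positive semidefinite matrices, so no
diagonalization is needed. -/
theorem trace_resolvent_triple_nonneg (hS : S.PosSemidef) (hl : 0 < lam) {b : ℝ} (hb : 0 ≤ b) :
    0 ≤ (matResolvent S lam * S * matResolvent (b • S) lam).trace := by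
  have hST : Sᵀ = S := by simpa [Matrix.IsHermitian] using hS.isHermitian
  have h1 := matResolvent_mul_add hS hl
  have h2 := add_mul_matResolvent (hS.smul hb) hl
  have hcK := commute_matResolvent hS hl zero_le_one
  rw [one_smul] at hcK
  have hBT := matResolvent_transpose (hS.smul hb) hl
  have hKT := matResolvent_transpose hS hl
  set B := matResolvent (b • S) lam
  set K := matResolvent S lam
  have hSS : (S * S).PosSemidef := by
    simpa [hST] using Matrix.posSemidef_conjTranspose_mul_self S
  have hKS : (K * S).PosSemidef := by
    have e : K * S = K * (S * S + lam • S) * Kᴴ := by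
      have h3 := add_mul_matResolvent hS hl
      calc K * S = K * S * ((S + lam • 1) * K) := by rw [h3, mul_one]
        _ = _ := by
          simp [hKT, mul_add, add_mul, mul_assoc]
    rw [e]
    exact (hSS.add (hS.smul hl.le)).mul_mul_conjTranspose_same K
  have hSKS : (S * (K * S)).PosSemidef := by
    have e : S * (K * S) = S * K * Sᴴ := by simp [hST, mul_assoc]
    rw [e]
    exact (matResolvent_posSemidef hS hl).mul_mul_conjTranspose_same S
  have e : K * S * B = B * (b • (S * (K * S)) + lam • (K * S)) * Bᴴ := by
    calc K * S * B = (B * (b • S + lam • 1)) * (K * S * B) := by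
          rw [matResolvent_mul_add (hS.smul hb) hl, one_mul]
      _ = _ := by simp [hBT, mul_add, add_mul, mul_assoc]
  rw [e]
  exact (((hSKS.smul hb).add (hKS.smul hl.le)).mul_mul_conjTranspose_same B).trace_nonneg

/-- The trace of `(b S + λ) R = 1`. In this form `b` enters the fixed point equation only through
`tr R`, whose increments the resolvent identity controls. -/
theorem trace_mul_matResolvent_eq (hS : S.PosSemidef) (hl : 0 < lam) {b : ℝ} (hb : 0 ≤ b) :
    b * (S * matResolvent (b • S) lam).trace = d - lam * (matResolvent (b • S) lam).trace := by
  have h := congrArg Matrix.trace (add_mul_matResolvent (hS.smul hb) hl)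
  rw [add_mul, Matrix.trace_add, smul_mul_assoc, smul_mul_assoc, one_mul, Matrix.trace_smul,
    Matrix.trace_smul, Matrix.trace_one, Fintype.card_fin, smul_eq_mul, smul_eq_mul] at h
  linarith

theorem effDim_eq_trace : effDim S lam = (S * matResolvent S lam).trace := rfl

theorem effDim_le (hS : S.PosSemidef) (hl : 0 < lam) : effDim S lam ≤ d := by
  have h := trace_mul_matResolvent_eq hS hl zero_le_one
  rw [one_smul, one_mul] at h
  have := (matResolvent_posSemidef hS hl).trace_nonneg
  rw [effDim_eq_trace, h]
  nlinarith

/-- An approximate solution `b` of the fixed point equation solved by `1` is close to `1`. -/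
theorem abs_sub_one_le_of_fixedPoint (hS : S.PosSemidef) (hl : 0 < lam) {b g c η : ℝ} (hb : 0 ≤ b)
    (hg : 0 ≤ g) (hc : c = 1 + g * effDim S lam)
    (h : |c - (b + g * (b * (S * matResolvent (b • S) lam).trace))| ≤ η) : |b - 1| ≤ η := by
  rw [trace_mul_matResolvent_eq hS hl hb, hc, effDim_eq_trace] at h
  have h1 := trace_mul_matResolvent_eq hS hl zero_le_one
  rw [one_smul, one_mul] at h1
  rw [h1] at h
  have h2 := congrArg Matrix.trace (matResolvent_smul_sub hS hl hb)
  rw [Matrix.trace_sub, Matrix.trace_smul, smul_eq_mul] at h2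
  have h3 := trace_resolvent_triple_nonneg hS hl hb
  set τ := (matResolvent S lam * S * matResolvent (b • S) lam).trace
  -- The defect factors as `b - 1` times a quantity that is at least one, since `τ ≥ 0`: this is the
  -- stability of the root `b = 1`.
  have e : 1 + g * (d - lam * (matResolvent S lam).trace) -
      (b + g * (d - lam * (matResolvent (b • S) lam).trace)) = -((b - 1) * (1 + g * lam * τ)) := by
    linear_combination (-(g * lam)) * h2
  have h4 : 0 ≤ g * lam * τ := by positivity
  rw [e, abs_neg, abs_mul, abs_of_pos (by linarith : 0 < 1 + g * lam * τ)] at h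
  nlinarith [abs_nonneg (b - 1)]

theorem norm_matResolvent_sub_le (hS : S.PosSemidef) (hl : 0 < lam) {b s : ℝ} (hb : 0 ≤ b)
    (hs : ‖S‖ ≤ s) :
    ‖matResolvent S lam - matResolvent (b • S) lam‖ ≤ |b - 1| * (s / lam ^ 2) := by
  rw [matResolvent_smul_sub hS hl hb, norm_smul, Real.norm_eq_abs]
  gcongr
  calc ‖matResolvent S lam * S * matResolvent (b • S) lam‖
      ≤ ‖matResolvent S lam‖ * ‖S‖ * ‖matResolvent (b • S) lam‖ :=
        (norm_mul_le _ _).trans (by gcongr; exact norm_mul_le _ _)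
    _ ≤ lam⁻¹ * s * lam⁻¹ := by
        have := (norm_nonneg S).trans hs
        gcongr
        · exact norm_matResolvent_le hS hl
        · exact norm_matResolvent_le (hS.smul hb) hl
    _ = s / lam ^ 2 := by field_simp

end Monotone

/-! ### Moments of a single row -/

section Moments

variable {d : ℕ} {P : Measure (EuclideanSpace ℝ (Fin d))} {C : ℝ≥0}

theorem continuous_quad (Q : Matrix (Fin d) (Fin d) ℝ) :
    Continuous fun z : EuclideanSpace ℝ (Fin d) => z.ofLp ⬝ᵥ Q *ᵥ z.ofLp := by
  unfold Matrix.mulVec dotProduct; fun_prop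

theorem integrable_inner_pow_four (hM : fourthMoment P ≤ C) {e : EuclideanSpace ℝ (Fin d)}
    (he : ‖e‖ = 1) :
    Integrable (fun z => inner ℝ e z ^ 4) P ∧ ∫ z, inner ℝ e z ^ 4 ∂P ≤ C := by
  have h1 : ∫⁻ x, ENNReal.ofReal (inner ℝ e x ^ 4) ∂P ≤ C :=
    (le_iSup₂ (f := fun (e : EuclideanSpace ℝ (Fin d)) (_ : ‖e‖ = 1) =>
      ∫⁻ x, ENNReal.ofReal (inner ℝ e x ^ 4) ∂P) e he).trans hM
  have hm : AEStronglyMeasurable (fun z => inner ℝ e z ^ 4) P :=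
    (by fun_prop : Continuous fun z : EuclideanSpace ℝ (Fin d) =>
      inner ℝ e z ^ 4).aestronglyMeasurable
  have h0 : 0 ≤ᵐ[P] fun z => inner ℝ e z ^ 4 := ae_of_all _ fun z => by positivity
  refine ⟨(lintegral_ofReal_ne_top_iff_integrable hm h0).1
    (ne_top_of_le_ne_top ENNReal.coe_ne_top h1), ?_⟩
  rw [integral_eq_lintegral_of_nonneg_ae h0 hm]
  exact ENNReal.toReal_le_of_le_ofReal C.2 (by simpa using h1)

theorem dotProduct_eq_inner (u : Fin d → ℝ) (z : EuclideanSpace ℝ (Fin d)) :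
    u ⬝ᵥ z.ofLp = inner ℝ (WithLp.toLp 2 u) z := by
  rw [EuclideanSpace.inner_eq_star_dotProduct]
  simp [dotProduct_comm]

/-- Cauchy–Schwarz over the coordinates costs a factor depending on `d`; this is harmless, as only
integrability is drawn from it. -/
theorem integrable_norm_pow_four (hM : fourthMoment P ≤ C) :
    Integrable (fun z => ‖z‖ ^ 4) P := by
  have hi : ∀ i : Fin d, Integrable (fun z : EuclideanSpace ℝ (Fin d) => z i ^ 4) P := fun i => by
    have := (integrable_inner_pow_four hM (e := EuclideanSpace.single i (1 : ℝ)) (by simp)).1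
    simpa [EuclideanSpace.inner_single_left] using this
  have hs := (integrable_finsetSum Finset.univ fun i _ => hi i).const_mul (d : ℝ)
  refine hs.mono' (by fun_prop) (ae_of_all _ fun z => ?_)
  rw [Real.norm_of_nonneg (by positivity)]
  have h := sq_sum_le_card_mul_sum_sq (s := (Finset.univ : Finset (Fin d)))
    (f := fun i => (z i) ^ 2)
  calc ‖z‖ ^ 4 = (‖z‖ ^ 2) ^ 2 := by ring
    _ = (∑ i, z i ^ 2) ^ 2 := by simp [EuclideanSpace.norm_sq_eq]
    _ ≤ _ := h.trans (le_of_eq (by simp [← pow_mul]))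

variable [IsProbabilityMeasure P]

/-- Continuous functions of at most quartic growth are integrable. -/
theorem integrable_of_quartic (hM : fourthMoment P ≤ C) {f : EuclideanSpace ℝ (Fin d) → ℝ}
    (hf : Continuous f) (K : ℝ) (h : ∀ z, |f z| ≤ K * (1 + ‖z‖ ^ 4)) : Integrable f P :=
  (((integrable_const 1).add (integrable_norm_pow_four hM)).const_mul K).mono'
    hf.aestronglyMeasurable (ae_of_all _ h)

theorem integrable_of_quadratic (hM : fourthMoment P ≤ C) {f : EuclideanSpace ℝ (Fin d) → ℝ}
    (hf : Continuous f) (K : ℝ) (hK : 0 ≤ K) (h : ∀ z, |f z| ≤ K * ‖z‖ ^ 2) : Integrable f P := by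
  refine integrable_of_quartic hM hf K fun z => (h z).trans ?_
  gcongr
  nlinarith [sq_nonneg (‖z‖ ^ 2 - 1)]

theorem integral_dot_pow_four_le (hM : fourthMoment P ≤ C) (u : Fin d → ℝ) :
    Integrable (fun z : EuclideanSpace ℝ (Fin d) => (u ⬝ᵥ z.ofLp) ^ 4) P ∧
      ∫ z, (u ⬝ᵥ z.ofLp) ^ 4 ∂P ≤ C * eNorm u ^ 4 := by
  rcases eq_or_ne u 0 with rfl | hu
  · simp [eNorm]
  have hn : 0 < eNorm u := by rw [norm_pos_iff]; simpa using hu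
  have he : ‖(eNorm u)⁻¹ • WithLp.toLp 2 u‖ = 1 := by
    rw [norm_smul, norm_inv, norm_norm, inv_mul_cancel₀ hn.ne']
  obtain ⟨h1, h2⟩ := integrable_inner_pow_four hM he
  have e : (fun z : EuclideanSpace ℝ (Fin d) => (u ⬝ᵥ z.ofLp) ^ 4) =
      fun z => eNorm u ^ 4 * inner ℝ ((eNorm u)⁻¹ • WithLp.toLp 2 u) z ^ 4 := by
    ext1 z
    rw [real_inner_smul_left, ← dotProduct_eq_inner]
    field_simp
  rw [e, integral_const_mul, mul_comm (C : ℝ)]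
  exact ⟨h1.const_mul _, by gcongr⟩

theorem memLp_coord (hM : fourthMoment P ≤ C) (i : Fin d) :
    MemLp (fun z : EuclideanSpace ℝ (Fin d) => z i) 2 P := by
  rw [memLp_two_iff_integrable_sq (by fun_prop)]
  refine integrable_of_quadratic hM (by fun_prop) 1 zero_le_one fun z => ?_
  rw [abs_of_nonneg (sq_nonneg _), one_mul]
  have := PiLp.norm_apply_le z i
  rw [← sq_abs, ← Real.norm_eq_abs]
  gcongr

theorem integrable_id_of_fourthMoment (hM : fourthMoment P ≤ C) :
    Integrable (fun z : EuclideanSpace ℝ (Fin d) => z) P := by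
  rw [← integrable_norm_iff (by fun_prop)]
  refine integrable_of_quartic hM (by fun_prop) 1 fun z => ?_
  rw [abs_of_nonneg (norm_nonneg _)]
  nlinarith [sq_nonneg (‖z‖ ^ 2 - 1), sq_nonneg (‖z‖ - 1), sq_nonneg (‖z‖ ^ 2)]

theorem integral_coord_eq_zero (hM : fourthMoment P ≤ C) (hmean : ∫ x, x ∂P = 0) (i : Fin d) :
    ∫ z : EuclideanSpace ℝ (Fin d), z i ∂P = 0 := by
  have h := (EuclideanSpace.proj (𝕜 := ℝ) i : EuclideanSpace ℝ (Fin d) →L[ℝ] ℝ).integral_comp_comm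
    (integrable_id_of_fourthMoment hM)
  rw [hmean, map_zero] at h
  exact h

theorem covMatrix_apply (hM : fourthMoment P ≤ C) (hmean : ∫ x, x ∂P = 0) (i j : Fin d) :
    covMatrix P i j = ∫ z, z i * z j ∂P := by
  simp [covMatrix, covariance, integral_coord_eq_zero hM hmean]

theorem abs_quad_le (Q : Matrix (Fin d) (Fin d) ℝ) (z : EuclideanSpace ℝ (Fin d)) :
    |z.ofLp ⬝ᵥ Q *ᵥ z.ofLp| ≤ ‖Q‖ * ‖z‖ ^ 2 := by
  have := abs_bilin_le Q z.ofLp z.ofLp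
  rwa [eNorm, WithLp.toLp_ofLp, mul_assoc, ← sq] at this

theorem integrable_quad (hM : fourthMoment P ≤ C) (Q : Matrix (Fin d) (Fin d) ℝ) :
    Integrable (fun z : EuclideanSpace ℝ (Fin d) => z.ofLp ⬝ᵥ Q *ᵥ z.ofLp) P :=
  integrable_of_quadratic hM (continuous_quad Q) ‖Q‖ (norm_nonneg _) (abs_quad_le Q)

theorem integral_quad (hM : fourthMoment P ≤ C) (hmean : ∫ x, x ∂P = 0)
    (Q : Matrix (Fin d) (Fin d) ℝ) :
    ∫ z, z.ofLp ⬝ᵥ Q *ᵥ z.ofLp ∂P = (covMatrix P * Q).trace := by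
  have hint : ∀ i j : Fin d, Integrable (fun z : EuclideanSpace ℝ (Fin d) => z i * z j) P :=
    fun i j => (memLp_coord hM i).integrable_mul (memLp_coord hM j)
  have e : (fun z : EuclideanSpace ℝ (Fin d) => z.ofLp ⬝ᵥ Q *ᵥ z.ofLp) =
      fun z => ∑ i, ∑ j, Q i j * (z j * z i) := by
    ext1 z
    simp only [dotProduct, Matrix.mulVec, Finset.mul_sum]
    exact Finset.sum_congr rfl fun i _ => Finset.sum_congr rfl fun j _ => by ring
  have h1 : ∀ q : Fin d → Fin d → ℝ, ∫ z : EuclideanSpace ℝ (Fin d),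
      ∑ i, ∑ j, q i j * (z j * z i) ∂P = ∑ i, ∑ j, q i j * covMatrix P j i := fun q => by
    rw [integral_finsetSum _ fun i _ => integrable_finsetSum _ fun j _ => (hint j i).const_mul _]
    refine Finset.sum_congr rfl fun i _ => ?_
    rw [integral_finsetSum _ fun j _ => (hint j i).const_mul _]
    refine Finset.sum_congr rfl fun j _ => ?_
    rw [integral_const_mul, covMatrix_apply hM hmean]
  rw [e, h1 (fun i j => Q i j)]
  rw [Finset.sum_comm]
  simp [Matrix.trace, Matrix.mul_apply, mul_comm]

theorem dot_mul_dot_eq_quad (u v z : Fin d → ℝ) :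
    (u ⬝ᵥ z) * (v ⬝ᵥ z) = z ⬝ᵥ Matrix.vecMulVec u v *ᵥ z := by
  rw [Matrix.vecMulVec_mulVec, op_smul_eq_smul, dotProduct_smul, smul_eq_mul, dotProduct_comm z u,
    mul_comm]

theorem integrable_dot_mul_dot (hM : fourthMoment P ≤ C) (u v : Fin d → ℝ) :
    Integrable (fun z : EuclideanSpace ℝ (Fin d) => (u ⬝ᵥ z.ofLp) * (v ⬝ᵥ z.ofLp)) P := by
  simp_rw [dot_mul_dot_eq_quad]
  exact integrable_quad hM _

theorem integral_dot_mul_dot (hM : fourthMoment P ≤ C) (hmean : ∫ x, x ∂P = 0)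
    (u v : Fin d → ℝ) :
    ∫ z, (u ⬝ᵥ z.ofLp) * (v ⬝ᵥ z.ofLp) ∂P = u ⬝ᵥ covMatrix P *ᵥ v := by
  simp_rw [mul_comm (u ⬝ᵥ _), dot_mul_dot_eq_quad]
  rw [integral_quad hM hmean, trace_mul_vecMulVec]

theorem covMatrix_posSemidef (hM : fourthMoment P ≤ C) (hmean : ∫ x, x ∂P = 0) :
    (covMatrix P).PosSemidef := by
  refine .of_dotProduct_mulVec_nonneg (covMatrix_isHermitian P) fun x => ?_
  rw [star_trivial, ← integral_dot_mul_dot hM hmean]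
  exact integral_nonneg fun z => mul_self_nonneg _

/-- From `t² ≤ 1 + t⁴`, which keeps the constant free of square roots and of the dimension. -/
theorem integral_dot_sq_le (hM : fourthMoment P ≤ C) {u : Fin d → ℝ} {r : ℝ} (hu : eNorm u ≤ r) :
    ∫ z, (u ⬝ᵥ z.ofLp) ^ 2 ∂P ≤ 1 + C * r ^ 4 := by
  obtain ⟨h4, h4'⟩ := integral_dot_pow_four_le hM u
  calc ∫ z, (u ⬝ᵥ z.ofLp) ^ 2 ∂P ≤ ∫ z, (1 + (u ⬝ᵥ z.ofLp) ^ 4) ∂P := by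
        refine integral_mono ?_ ((integrable_const 1).add h4) fun z => ?_
        · simpa only [sq] using integrable_dot_mul_dot hM u u
        · simp only
          nlinarith [sq_nonneg ((u ⬝ᵥ z.ofLp) ^ 2 - 1)]
    _ = 1 + ∫ z, (u ⬝ᵥ z.ofLp) ^ 4 ∂P := by
        rw [integral_add (integrable_const 1) h4]; simp
    _ ≤ 1 + C * r ^ 4 := by
        have : eNorm u ^ 4 ≤ r ^ 4 := by gcongr
        have := mul_le_mul_of_nonneg_left this C.2
        simp only [NNReal.val_eq_coe] at this
        linarith

/-- Fourth moments in unit directions dominate second moments, and `|pq| ≤ (p² + q²)/2` passes to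
mixed ones. The bound is uniform in the dimension. -/
theorem norm_covMatrix_le (hM : fourthMoment P ≤ C) (hmean : ∫ x, x ∂P = 0) :
    ‖covMatrix P‖ ≤ 1 + C := by
  refine norm_le_of_abs_bilin_unit_le (by positivity) fun u v hu hv => ?_
  have hu2 := integral_dot_sq_le hM hu.le
  have hv2 := integral_dot_sq_le hM hv.le
  have iu := integrable_dot_mul_dot hM u u
  have iv := integrable_dot_mul_dot hM v v
  simp_rw [← sq] at iu iv
  rw [← integral_dot_mul_dot hM hmean]
  calc |∫ z, (u ⬝ᵥ z.ofLp) * (v ⬝ᵥ z.ofLp) ∂P|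
      ≤ ∫ z, |(u ⬝ᵥ z.ofLp) * (v ⬝ᵥ z.ofLp)| ∂P := abs_integral_le_integral_abs
    _ ≤ ∫ z, ((u ⬝ᵥ z.ofLp) ^ 2 + (v ⬝ᵥ z.ofLp) ^ 2) / 2 ∂P := by
        refine integral_mono (integrable_dot_mul_dot hM u v).abs ((iu.add iv).div_const 2)
          fun z => ?_
        simp only [abs_mul]
        rw [← sq_abs (u ⬝ᵥ _), ← sq_abs (v ⬝ᵥ _)]
        nlinarith [sq_nonneg (|u ⬝ᵥ z.ofLp| - |v ⬝ᵥ z.ofLp|)]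
    _ = (∫ z, (u ⬝ᵥ z.ofLp) ^ 2 ∂P + ∫ z, (v ⬝ᵥ z.ofLp) ^ 2 ∂P) / 2 := by
        rw [integral_div, integral_add iu iv]
    _ ≤ 1 + C := by linarith

/-- The variance bound behind `ν` is for `‖Q‖ = 1` and a form divided by `d`; homogeneity removes
both normalizations. The excluded case `Q = 0` is trivial and includes `d = 0`. -/
theorem integral_quad_sub_sq_le (hM : fourthMoment P ≤ C) (hmean : ∫ x, x ∂P = 0) {ν : ℝ}
    (hν0 : 0 ≤ ν) (hν : quadFormVar P ≤ ENNReal.ofReal ν) (Q : Matrix (Fin d) (Fin d) ℝ) :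
    Integrable (fun z : EuclideanSpace ℝ (Fin d) =>
        (z.ofLp ⬝ᵥ Q *ᵥ z.ofLp - (covMatrix P * Q).trace) ^ 2) P ∧
      ∫ z, (z.ofLp ⬝ᵥ Q *ᵥ z.ofLp - (covMatrix P * Q).trace) ^ 2 ∂P ≤ d ^ 2 * ν * ‖Q‖ ^ 2 := by
  have hcont : Continuous fun z : EuclideanSpace ℝ (Fin d) =>
      (z.ofLp ⬝ᵥ Q *ᵥ z.ofLp - (covMatrix P * Q).trace) ^ 2 :=
    ((continuous_quad Q).sub continuous_const).pow 2
  have hint : Integrable (fun z : EuclideanSpace ℝ (Fin d) =>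
      (z.ofLp ⬝ᵥ Q *ᵥ z.ofLp - (covMatrix P * Q).trace) ^ 2) P := by
    refine integrable_of_quartic hM hcont (2 * (‖Q‖ ^ 2 + (covMatrix P * Q).trace ^ 2))
      fun z => ?_
    rw [abs_of_nonneg (sq_nonneg _)]
    have h1 : (z.ofLp ⬝ᵥ Q *ᵥ z.ofLp) ^ 2 ≤ ‖Q‖ ^ 2 * ‖z‖ ^ 4 := by
      rw [← sq_abs]
      calc _ ≤ (‖Q‖ * ‖z‖ ^ 2) ^ 2 := by gcongr; exact abs_quad_le Q z
        _ = _ := by ring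
    have h2 : 0 ≤ (covMatrix P * Q).trace ^ 2 * ‖z‖ ^ 4 := by positivity
    nlinarith [sq_nonneg (z.ofLp ⬝ᵥ Q *ᵥ z.ofLp + (covMatrix P * Q).trace), sq_nonneg ‖Q‖]
  refine ⟨hint, ?_⟩
  rcases eq_or_ne Q 0 with rfl | hQ
  · simp
  have hd : (d : ℝ) ≠ 0 := by
    rintro h
    have : d = 0 := by exact_mod_cast h
    subst this
    exact hQ (Subsingleton.elim _ _)
  have hQn : 0 < ‖Q‖ := norm_pos_iff.2 hQ
  have hQ1 : ‖‖Q‖⁻¹ • Q‖ = 1 := by rw [norm_smul, norm_inv, norm_norm, inv_mul_cancel₀ hQn.ne']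
  have h1 := (le_iSup₂ (f := fun (Q : Matrix (Fin d) (Fin d) ℝ) (_ : ‖Q‖ = 1) =>
    evariance (fun x : EuclideanSpace ℝ (Fin d) => (x.ofLp ⬝ᵥ (Q *ᵥ x.ofLp)) / (d : ℝ)) P)
      _ hQ1).trans hν
  have e : (fun x : EuclideanSpace ℝ (Fin d) =>
      (x.ofLp ⬝ᵥ ((‖Q‖⁻¹ • Q) *ᵥ x.ofLp)) / (d : ℝ)) =
      fun x => (‖Q‖ * d)⁻¹ * (x.ofLp ⬝ᵥ (Q *ᵥ x.ofLp)) := by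
    ext1 x
    rw [Matrix.smul_mulVec, dotProduct_smul, smul_eq_mul]
    field_simp
  simp only [e] at h1
  rw [evariance_mul, evariance_eq_lintegral_ofReal, integral_quad hM hmean,
    ← ofReal_integral_eq_lintegral_ofReal hint (ae_of_all _ fun z => sq_nonneg _),
    ← ENNReal.ofReal_mul (sq_nonneg _), ENNReal.ofReal_le_ofReal_iff hν0] at h1
  rw [inv_pow, inv_mul_le_iff₀ (by positivity)] at h1
  linarith

end Moments

/-! ### Variance of functions with bounded differences on a product space -/

section BoundedDifferences

variable {α : Type*} [MeasurableSpace α] {P : Measure α} [IsProbabilityMeasure P]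

theorem measurePreserving_insertNth {m : ℕ} (i : Fin (m + 1)) :
    MeasurePreserving (fun p : (Fin m → α) × α => (i.insertNth p.2 p.1 : Fin (m + 1) → α))
      ((Measure.pi fun _ : Fin m => P).prod P) (Measure.pi fun _ : Fin (m + 1) => P) :=
  ((measurePreserving_piFinSuccAbove (fun _ : Fin (m + 1) => P) i).symm).comp
    Measure.measurePreserving_swap

theorem integral_pi_insertNth {m : ℕ} (i : Fin (m + 1)) {f : (Fin (m + 1) → α) → ℝ}
    (hf : Integrable f (Measure.pi fun _ => P)) :
    ∫ x, f x ∂(Measure.pi fun _ => P) =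
      ∫ w, ∫ z, f (i.insertNth z w) ∂P ∂(Measure.pi fun _ : Fin m => P) := by
  have hmp := measurePreserving_insertNth (P := P) i
  rw [← hmp.map_eq, integral_map hmp.aemeasurable (by rw [hmp.map_eq]; exact hf.1),
    integral_prod]
  exact (hmp.integrable_comp hf.1).2 hf

/-- Conditional bounds on the inner integral integrate to a bound on the whole. -/
theorem integral_pi_le_of_forall {m : ℕ} (i : Fin (m + 1)) {f : (Fin (m + 1) → α) → ℝ} {K : ℝ}
    (hf : Integrable f (Measure.pi fun _ => P)) (h : ∀ w, ∫ z, f (i.insertNth z w) ∂P ≤ K) :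
    ∫ x, f x ∂(Measure.pi fun _ => P) ≤ K := by
  have hmp := measurePreserving_insertNth (P := P) i
  rw [integral_pi_insertNth i hf]
  refine (integral_mono ?_ (integrable_const K) h).trans (by simp)
  exact ((hmp.integrable_comp hf.1).2 hf).integral_prod_left

/-- Efron–Stein by induction on the number of coordinates: integrating out the first one costs at
most `c²` of variance and leaves a function `G` of the others with the same bounded differences. -/
theorem integral_sub_integral_sq_le {n : ℕ} {f : (Fin n → α) → ℝ} (hf : Measurable f) {K c : ℝ}
    (hK : ∀ x, |f x| ≤ K)
    (hc : ∀ i x x', (∀ j, j ≠ i → x j = x' j) → |f x - f x'| ≤ c) :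
    ∫ x, (f x - ∫ x', f x' ∂(Measure.pi fun _ => P)) ^ 2 ∂(Measure.pi fun _ => P) ≤ n * c ^ 2 := by
  induction n with
  | zero =>
    have : ∀ x, f x = f default := fun x => congrArg f (Subsingleton.elim _ _)
    simp [this]
  | succ m ih =>
    set π := Measure.pi fun _ : Fin m => P
    have hmp := measurePreserving_insertNth (P := P) (0 : Fin (m + 1))
    have hfi : Integrable f (Measure.pi fun _ => P) :=
      .of_bound hf.aestronglyMeasurable K (ae_of_all _ hK)
    have hF : Measurable fun p : (Fin m → α) × α => f ((0 : Fin (m + 1)).insertNth p.2 p.1) :=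
      hf.comp hmp.measurable
    have hFw : ∀ w : Fin m → α, Measurable fun z : α => f ((0 : Fin (m + 1)).insertNth z w) :=
      fun w => hF.comp measurable_prodMk_left
    have hFi : ∀ w : Fin m → α, Integrable (fun z : α => f ((0 : Fin (m + 1)).insertNth z w)) P :=
      fun w => .of_bound (hFw w).aestronglyMeasurable K (ae_of_all _ fun _ => hK _)
    set G : (Fin m → α) → ℝ := fun w => ∫ z, f ((0 : Fin (m + 1)).insertNth z w) ∂P with hG
    have hGm : Measurable G := hF.stronglyMeasurable.integral_prod_right'.measurable
    have hGK : ∀ w, |G w| ≤ K := fun w => by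
      have := norm_integral_le_of_norm_le_const (μ := P)
        (f := fun z => f ((0 : Fin (m + 1)).insertNth z w)) (ae_of_all _ fun z => hK _)
      simpa [hG] using this
    have hGc : ∀ i w w', (∀ j, j ≠ i → w j = w' j) → |G w - G w'| ≤ c := fun i w w' h => by
      rw [hG, ← integral_sub (hFi w) (hFi w')]
      have := norm_integral_le_of_norm_le_const (μ := P) (C := c)
        (f := fun z => f ((0 : Fin (m + 1)).insertNth z w) - f ((0 : Fin (m + 1)).insertNth z w'))
        (ae_of_all _ fun z => hc i.succ _ _ fun j hj => ?_)
      · simpa using this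
      · refine Fin.cases ?_ (fun j hj => ?_) j hj
        · simp
        · have := h j (fun e => hj (by rw [e]))
          simpa using this
    have hmean : ∫ x, f x ∂(Measure.pi fun _ => P) = ∫ w, G w ∂π := integral_pi_insertNth 0 hfi
    have hGi : Integrable G π := .of_bound hGm.aestronglyMeasurable K (ae_of_all _ hGK)
    set M := ∫ w, G w ∂π
    have hsq : Integrable (fun x => (f x - M) ^ 2) (Measure.pi fun _ => P) := by
      refine .of_bound (by fun_prop) ((K + |M|) ^ 2) (ae_of_all _ fun x => ?_)
      rw [Real.norm_of_nonneg (sq_nonneg _), ← sq_abs]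
      gcongr
      exact (abs_sub _ _).trans (by gcongr; exact hK x)
    have hGsq : Integrable (fun w => (G w - M) ^ 2) π := by
      refine .of_bound (by fun_prop) ((K + |M|) ^ 2) (ae_of_all _ fun x => ?_)
      rw [Real.norm_of_nonneg (sq_nonneg _), ← sq_abs]
      gcongr
      exact (abs_sub _ _).trans (by gcongr; exact hGK x)
    rw [hmean, integral_pi_insertNth 0 hsq]
    have hin : ∀ w, ∫ z, (f ((0 : Fin (m + 1)).insertNth z w) - M) ^ 2 ∂P ≤
        c ^ 2 + (G w - M) ^ 2 := fun w => by
      have hdiff : ∀ z, |f ((0 : Fin (m + 1)).insertNth z w) - G w| ≤ c := fun z => by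
        -- The deviation from the conditional mean is an average of one-coordinate differences, each
        -- at most `c`.
        have e : f ((0 : Fin (m + 1)).insertNth z w) - G w =
            ∫ z', (f ((0 : Fin (m + 1)).insertNth z w) -
              f ((0 : Fin (m + 1)).insertNth z' w)) ∂P := by
          rw [integral_sub (integrable_const _) (hFi w)]; simp [hG]
        rw [e]
        have := norm_integral_le_of_norm_le_const (μ := P) (C := c)
          (f := fun z' => f ((0 : Fin (m + 1)).insertNth z w) -
            f ((0 : Fin (m + 1)).insertNth z' w))
          (ae_of_all _ fun z' => hc 0 _ _ fun j hj => ?_)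
        · simpa using this
        · refine Fin.cases (fun h => absurd rfl h) (fun j _ => ?_) j hj
          simp
      -- Conditional centering kills the cross term when the square is expanded around `G w`.
      have hz : ∫ z, (f ((0 : Fin (m + 1)).insertNth z w) - G w) ∂P = 0 := by
        rw [integral_sub (hFi w) (integrable_const _)]; simp [hG]
      have hi1 : Integrable (fun z => f ((0 : Fin (m + 1)).insertNth z w) - G w) P :=
        (hFi w).sub (integrable_const _)
      calc ∫ z, (f ((0 : Fin (m + 1)).insertNth z w) - M) ^ 2 ∂P
          ≤ ∫ z, (2 * (G w - M) * (f ((0 : Fin (m + 1)).insertNth z w) - G w) +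
              (c ^ 2 + (G w - M) ^ 2)) ∂P := by
            refine integral_mono_of_nonneg (ae_of_all _ fun z => sq_nonneg _)
              ((hi1.const_mul _).add (integrable_const _)) (ae_of_all _ fun z => ?_)
            have h1 : (f ((0 : Fin (m + 1)).insertNth z w) - G w) ^ 2 ≤ c ^ 2 := by
              rw [← sq_abs]; gcongr; exact hdiff z
            simp only
            linear_combination h1
        _ = c ^ 2 + (G w - M) ^ 2 := by
            rw [integral_add (hi1.const_mul _) (integrable_const _), integral_const_mul, hz]
            simp
    calc _ ≤ ∫ w, (c ^ 2 + (G w - M) ^ 2) ∂π :=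
          integral_mono_of_nonneg (ae_of_all _ fun w => integral_nonneg fun z => sq_nonneg _)
            ((integrable_const _).add hGsq) (ae_of_all _ hin)
      _ = c ^ 2 + ∫ w, (G w - M) ^ 2 ∂π := by
          rw [integral_add (integrable_const _) hGsq]; simp
      _ ≤ c ^ 2 + m * c ^ 2 := by gcongr; exact ih hGm hGK hGc
      _ = _ := by push_cast; ring

end BoundedDifferences

/-! ### The sample resolvent with one row removed -/

section LeaveOneOut

variable {d : ℕ}

/-- The matrix `g ∑ x_i x_iᵀ`. -/
noncomputable def rowGram (g : ℝ) {n : ℕ} (x : Fin n → EuclideanSpace ℝ (Fin d)) :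
    Matrix (Fin d) (Fin d) ℝ :=
  g • ∑ i, Matrix.vecMulVec (x i).ofLp (x i).ofLp

/-- The resolvent `(g ∑ x_i x_iᵀ + λ I)⁻¹`. -/
noncomputable def rowRes (g lam : ℝ) {n : ℕ} (x : Fin n → EuclideanSpace ℝ (Fin d)) :
    Matrix (Fin d) (Fin d) ℝ :=
  matResolvent (rowGram g x) lam

theorem rowGram_posSemidef {g : ℝ} (hg : 0 ≤ g) {n : ℕ} (x : Fin n → EuclideanSpace ℝ (Fin d)) :
    (rowGram g x).PosSemidef :=
  (Matrix.posSemidef_sum _ fun _ _ => vecMulVec_self_posSemidef _).smul hg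

theorem continuous_rowGram (g : ℝ) (n : ℕ) :
    Continuous fun x : Fin n → EuclideanSpace ℝ (Fin d) => rowGram g x := by
  have h : Continuous fun x : Fin n → EuclideanSpace ℝ (Fin d) =>
      ∑ i, Matrix.vecMulVec (x i).ofLp (x i).ofLp :=
    continuous_finsetSum _ fun i _ => Continuous.matrix_vecMulVec (by fun_prop) (by fun_prop)
  exact h.const_smul g

theorem continuous_rowRes {g lam : ℝ} (hg : 0 ≤ g) (hl : 0 < lam) (n : ℕ) :
    Continuous fun x : Fin n → EuclideanSpace ℝ (Fin d) => rowRes g lam x :=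
  continuous_matResolvent (continuous_rowGram g n) (rowGram_posSemidef hg) hl

theorem norm_rowRes_le {g lam : ℝ} (hg : 0 ≤ g) (hl : 0 < lam) {n : ℕ}
    (x : Fin n → EuclideanSpace ℝ (Fin d)) : ‖rowRes g lam x‖ ≤ lam⁻¹ :=
  norm_matResolvent_le (rowGram_posSemidef hg x) hl

theorem rowGram_insertNth (g : ℝ) {m : ℕ} (i : Fin (m + 1)) (z : EuclideanSpace ℝ (Fin d))
    (w : Fin m → EuclideanSpace ℝ (Fin d)) :
    rowGram g (i.insertNth z w : Fin (m + 1) → EuclideanSpace ℝ (Fin d)) =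
      rowGram g w + g • Matrix.vecMulVec z.ofLp z.ofLp := by
  rw [rowGram, rowGram, Fin.sum_univ_succAbove _ i, smul_add, add_comm]
  simp

/-- The remaining rows. -/
def dropRow {m : ℕ} (i : Fin (m + 1)) (x : Fin (m + 1) → EuclideanSpace ℝ (Fin d)) :
    Fin m → EuclideanSpace ℝ (Fin d) := fun j => x (i.succAbove j)

theorem dropRow_insertNth {m : ℕ} (i : Fin (m + 1)) (z : EuclideanSpace ℝ (Fin d))
    (w : Fin m → EuclideanSpace ℝ (Fin d)) :
    dropRow i (i.insertNth z w : Fin (m + 1) → EuclideanSpace ℝ (Fin d)) = w := by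
  ext1 j; simp [dropRow]

theorem insertNth_dropRow {m : ℕ} (i : Fin (m + 1)) (x : Fin (m + 1) → EuclideanSpace ℝ (Fin d)) :
    (i.insertNth (x i) (dropRow i x) : Fin (m + 1) → EuclideanSpace ℝ (Fin d)) = x :=
  Fin.insertNth_self_removeNth i x

theorem continuous_dropRow {m : ℕ} (i : Fin (m + 1)) :
    Continuous (dropRow i : (Fin (m + 1) → EuclideanSpace ℝ (Fin d)) → _) := by
  unfold dropRow; fun_prop

theorem rowGram_eq_dropRow (g : ℝ) {m : ℕ} (i : Fin (m + 1))
    (x : Fin (m + 1) → EuclideanSpace ℝ (Fin d)) :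
    rowGram g x = rowGram g (dropRow i x) + g • Matrix.vecMulVec (x i).ofLp (x i).ofLp := by
  conv_lhs => rw [← insertNth_dropRow i x]
  exact rowGram_insertNth g i _ _

theorem trace_rowRes_sub_mem {g lam s : ℝ} (hg : 0 ≤ g) (hl : 0 < lam) {m : ℕ}
    (i : Fin (m + 1)) (x : Fin (m + 1) → EuclideanSpace ℝ (Fin d))
    {S : Matrix (Fin d) (Fin d) ℝ} (hS : S.PosSemidef) (hs : ‖S‖ ≤ s) :
    (S * rowRes g lam (dropRow i x)).trace - (S * rowRes g lam x).trace ∈ Set.Icc 0 (s / lam) := by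
  have := trace_mul_matResolvent_sub (rowGram_posSemidef hg (dropRow i x)) hl hg (x i).ofLp hS hs
  rwa [← rowGram_eq_dropRow] at this

/-- The error made in one summand when `x_iᵀ R v` is decoupled. -/
theorem abs_decouple_le {W : Matrix (Fin d) (Fin d) ℝ} {lam g a : ℝ} (hW : W.PosSemidef)
    (hl : 0 < lam) (hg : 0 ≤ g) (ha : 0 ≤ a) (z u v t : Fin d → ℝ) :
    |(u ⬝ᵥ matResolvent (W + g • Matrix.vecMulVec z z) lam *ᵥ z) * (v ⬝ᵥ z) -
      (1 + a)⁻¹ * (u ⬝ᵥ matResolvent (W + g • Matrix.vecMulVec z z) lam *ᵥ t) -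
      (1 + a)⁻¹ * ((u ⬝ᵥ matResolvent W lam *ᵥ z) * (v ⬝ᵥ z) - u ⬝ᵥ matResolvent W lam *ᵥ t)| ≤
    |u ⬝ᵥ matResolvent W lam *ᵥ z| * |v ⬝ᵥ z| * |g * (z ⬝ᵥ matResolvent W lam *ᵥ z) - a| +
      g * |u ⬝ᵥ matResolvent W lam *ᵥ z| * |z ⬝ᵥ matResolvent W lam *ᵥ t| := by
  rw [matResolvent_add_vecMulVec_mulVec_self hW hl hg,
    matResolvent_add_vecMulVec_mulVec hW hl hg, dotProduct_sub, dotProduct_smul, dotProduct_smul,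
    smul_eq_mul, smul_eq_mul]
  have hα0 : 0 ≤ z ⬝ᵥ matResolvent W lam *ᵥ z :=
    quad_nonneg_of_posSemidef (matResolvent_posSemidef hW hl) z
  set p := u ⬝ᵥ matResolvent W lam *ᵥ z
  set q := v ⬝ᵥ z
  set p' := z ⬝ᵥ matResolvent W lam *ᵥ t
  set α := g * (z ⬝ᵥ matResolvent W lam *ᵥ z)
  have hα : 0 ≤ α := by positivity
  -- Two error sources appear: replacing the random `α` by `a`, and replacing `R` by the
  -- leave-one-out resolvent in the term with `t`. The prefactors are at most one since `α, a ≥ 0`.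
  have e : (1 + α)⁻¹ * p * q - (1 + a)⁻¹ * (u ⬝ᵥ matResolvent W lam *ᵥ t - g * p' / (1 + α) * p) -
      (1 + a)⁻¹ * (p * q - u ⬝ᵥ matResolvent W lam *ᵥ t) =
      -((1 + α)⁻¹ * (1 + a)⁻¹ * (p * q * (α - a))) + (1 + α)⁻¹ * (1 + a)⁻¹ * (g * p * p') := by
    field_simp
    ring
  have h1 : (1 + α)⁻¹ * (1 + a)⁻¹ ≤ 1 :=
    mul_le_one₀ (inv_le_one_of_one_le₀ (by linarith)) (by positivity)
      (inv_le_one_of_one_le₀ (by linarith))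
  have h0 : 0 ≤ (1 + α)⁻¹ * (1 + a)⁻¹ := by positivity
  rw [e]
  refine (abs_add_le _ _).trans (add_le_add ?_ ?_)
  · rw [abs_neg, abs_mul, abs_of_nonneg h0, abs_mul, abs_mul]
    exact mul_le_of_le_one_left (by positivity) h1
  · rw [abs_mul, abs_of_nonneg h0, abs_mul, abs_mul, abs_of_nonneg hg]
    exact mul_le_of_le_one_left (by positivity) h1

variable {P : Measure (EuclideanSpace ℝ (Fin d))} [IsProbabilityMeasure P] {C : ℝ≥0}

/-- Continuous functions of at most quartic growth in one row are integrable. -/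
theorem integrable_pi_of_quartic (hM : fourthMoment P ≤ C) {n : ℕ} (i : Fin n)
    {f : (Fin n → EuclideanSpace ℝ (Fin d)) → ℝ} (hf : Continuous f) (K : ℝ)
    (h : ∀ x, |f x| ≤ K * (1 + ‖x i‖ ^ 4)) : Integrable f (Measure.pi fun _ => P) := by
  have h1 : Integrable (fun x : Fin n → EuclideanSpace ℝ (Fin d) => ‖x i‖ ^ 4)
      (Measure.pi fun _ => P) :=
    ((measurePreserving_eval (fun _ : Fin n => P) i).integrable_comp
      (g := fun z : EuclideanSpace ℝ (Fin d) => ‖z‖ ^ 4) (by fun_prop)).2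
        (integrable_norm_pow_four hM)
  exact (((integrable_const 1).add h1).const_mul K).mono' hf.aestronglyMeasurable (ae_of_all _ h)

theorem integrable_pi_of_bound {n : ℕ} {f : (Fin n → EuclideanSpace ℝ (Fin d)) → ℝ}
    (hf : Continuous f) (K : ℝ) (h : ∀ x, |f x| ≤ K) : Integrable f (Measure.pi fun _ => P) :=
  .of_bound hf.aestronglyMeasurable K (ae_of_all _ h)

theorem eNorm_ofLp (z : EuclideanSpace ℝ (Fin d)) : eNorm z.ofLp = ‖z‖ := rfl

theorem eNorm_nonneg (v : Fin d → ℝ) : 0 ≤ eNorm v := norm_nonneg _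

/-- Moments of `xᵢ · y` for a bounded vector `y` depending on the other rows only. -/
theorem integral_dot_dropRow_pow_four_le (hM : fourthMoment P ≤ C) {m : ℕ} (i : Fin (m + 1))
    {y : (Fin m → EuclideanSpace ℝ (Fin d)) → Fin d → ℝ} (hy : Continuous y) {r : ℝ}
    (hr : ∀ w, eNorm (y w) ≤ r) :
    Integrable (fun x : Fin (m + 1) → EuclideanSpace ℝ (Fin d) =>
        (y (dropRow i x) ⬝ᵥ (x i).ofLp) ^ 4) (Measure.pi fun _ => P) ∧
      ∫ x, (y (dropRow i x) ⬝ᵥ (x i).ofLp) ^ 4 ∂(Measure.pi fun _ => P) ≤ C * r ^ 4 := by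
  have hcd := continuous_dropRow (d := d) i
  have hint : Integrable (fun x : Fin (m + 1) → EuclideanSpace ℝ (Fin d) =>
      (y (dropRow i x) ⬝ᵥ (x i).ofLp) ^ 4) (Measure.pi fun _ => P) := by
    refine integrable_pi_of_quartic hM i (by fun_prop) (r ^ 4) fun x => ?_
    rw [abs_of_nonneg (by positivity), ← Even.pow_abs (by decide : Even 4)]
    calc |y (dropRow i x) ⬝ᵥ (x i).ofLp| ^ 4 ≤ (r * ‖x i‖) ^ 4 := by
          gcongr
          refine (abs_dotProduct_le _ _).trans ?_
          rw [eNorm_ofLp]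
          gcongr
          exact hr _
      _ = r ^ 4 * ‖x i‖ ^ 4 := by ring
      _ ≤ _ := by gcongr; linarith
  refine ⟨hint, integral_pi_le_of_forall i hint fun w => ?_⟩
  simp only [dropRow_insertNth, Fin.insertNth_apply_same]
  refine (integral_dot_pow_four_le hM (y w)).2.trans ?_
  have := eNorm_nonneg (y w)
  gcongr
  exact hr w

end LeaveOneOut

/-! ### Concentration of the quadratic form and decoupling of one row -/

section Decoupling

variable {d : ℕ} {P : Measure (EuclideanSpace ℝ (Fin d))} [IsProbabilityMeasure P] {C : ℝ≥0}

theorem sub_sq_le_quartic {y k A D t : ℝ} (hy : |y| ≤ A * t ^ 2) (hk : |k| ≤ D) :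
    (y - k) ^ 2 ≤ 2 * (A ^ 2 + D ^ 2) * (1 + t ^ 4) := by
  have h1 : y ^ 2 ≤ (A * t ^ 2) ^ 2 := by rw [← sq_abs]; gcongr
  have h2 : k ^ 2 ≤ D ^ 2 := by rw [← sq_abs]; gcongr
  have h3 : 0 ≤ D ^ 2 * t ^ 4 := by positivity
  nlinarith [sq_nonneg (y + k), sq_nonneg A]

theorem abs_trace_covMatrix_mul_le (hM : fourthMoment P ≤ C) (hmean : ∫ x, x ∂P = 0)
    {B : Matrix (Fin d) (Fin d) ℝ} {L : ℝ} (hB : ‖B‖ ≤ L) :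
    |(covMatrix P * B).trace| ≤ d * ((1 + C) * L) := by
  refine (abs_trace_le _).trans ?_
  gcongr
  exact (norm_mul_le _ _).trans
    (mul_le_mul (norm_covMatrix_le hM hmean) hB (norm_nonneg _) (by positivity))

theorem integral_trace_sub_sq_le (hM : fourthMoment P ≤ C) (hmean : ∫ x, x ∂P = 0) {g lam : ℝ}
    (hg : 0 ≤ g) (hl : 0 < lam) (n : ℕ) :
    ∫ x, ((covMatrix P * rowRes g lam x).trace -
        ∫ x', (covMatrix P * rowRes g lam x').trace ∂(Measure.pi fun _ : Fin n => P)) ^ 2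
      ∂(Measure.pi fun _ : Fin n => P) ≤ n * ((1 + C) / lam) ^ 2 := by
  have hR := continuous_rowRes (d := d) hg hl n
  have hc : Continuous fun x : Fin n → EuclideanSpace ℝ (Fin d) =>
      (covMatrix P * rowRes g lam x).trace := by fun_prop
  refine integral_sub_integral_sq_le hc.measurable
    (fun x => abs_trace_covMatrix_mul_le hM hmean (norm_rowRes_le hg hl x)) fun i x x' h => ?_
  cases n with
  | zero => exact i.elim0
  | succ m =>
    have h1 := trace_rowRes_sub_mem hg hl i x (covMatrix_posSemidef hM hmean)
      (norm_covMatrix_le hM hmean)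
    have h2 := trace_rowRes_sub_mem hg hl i x' (covMatrix_posSemidef hM hmean)
      (norm_covMatrix_le hM hmean)
    -- Both traces lie within `(1 + C)/λ` below the same leave-one-out trace, so their difference is
    -- at most `(1 + C)/λ`, with no factor two.
    have e : dropRow i x = dropRow i x' := funext fun j => h _ (Fin.succAbove_ne i j)
    rw [e] at h1
    rw [abs_le]
    constructor <;> linarith [h1.1, h1.2, h2.1, h2.2]

/-- Conditionally on the other rows the leave-one-out resolvent is a fixed matrix of norm at most
`λ⁻¹`, so the one-row variance bound applies. -/
theorem integral_quad_dropRow_sub_sq_le (hM : fourthMoment P ≤ C) (hmean : ∫ x, x ∂P = 0)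
    {ν : ℝ} (hν0 : 0 ≤ ν) (hν : quadFormVar P ≤ ENNReal.ofReal ν) {g lam : ℝ}
    (hg : 0 ≤ g) (hl : 0 < lam) {m : ℕ} (i : Fin (m + 1)) :
    Integrable (fun x : Fin (m + 1) → EuclideanSpace ℝ (Fin d) =>
      ((x i).ofLp ⬝ᵥ rowRes g lam (dropRow i x) *ᵥ (x i).ofLp -
        (covMatrix P * rowRes g lam (dropRow i x)).trace) ^ 2) (Measure.pi fun _ => P) ∧
    ∫ x, ((x i).ofLp ⬝ᵥ rowRes g lam (dropRow i x) *ᵥ (x i).ofLp -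
        (covMatrix P * rowRes g lam (dropRow i x)).trace) ^ 2
      ∂(Measure.pi fun _ : Fin (m + 1) => P) ≤ d ^ 2 * ν * lam⁻¹ ^ 2 := by
  have hB := (continuous_rowRes (d := d) hg hl m).comp (continuous_dropRow i)
  simp only [Function.comp_def] at hB
  have hint : Integrable (fun x : Fin (m + 1) → EuclideanSpace ℝ (Fin d) =>
      ((x i).ofLp ⬝ᵥ rowRes g lam (dropRow i x) *ᵥ (x i).ofLp -
        (covMatrix P * rowRes g lam (dropRow i x)).trace) ^ 2) (Measure.pi fun _ => P) := by
    refine integrable_pi_of_quartic hM i (by fun_prop)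
      (2 * (lam⁻¹ ^ 2 + (d * ((1 + C) * lam⁻¹)) ^ 2)) fun x => ?_
    rw [abs_of_nonneg (sq_nonneg _)]
    refine sub_sq_le_quartic ((abs_quad_le _ _).trans ?_)
      (abs_trace_covMatrix_mul_le hM hmean (norm_rowRes_le hg hl _))
    gcongr
    exact norm_rowRes_le hg hl _
  refine ⟨hint, integral_pi_le_of_forall i hint fun w => ?_⟩
  simp only [dropRow_insertNth, Fin.insertNth_apply_same]
  refine (integral_quad_sub_sq_le hM hmean hν0 hν _).2.trans ?_
  gcongr
  exact norm_rowRes_le hg hl _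

/-- The quantity `g E tr (Σ R)`. -/
noncomputable def meanTrace (P : Measure (EuclideanSpace ℝ (Fin d))) (g lam : ℝ) (n : ℕ) : ℝ :=
  g * ∫ x, (covMatrix P * rowRes g lam x).trace ∂(Measure.pi fun _ : Fin n => P)

theorem meanTrace_nonneg (hM : fourthMoment P ≤ C) (hmean : ∫ x, x ∂P = 0) {g lam : ℝ}
    (hg : 0 ≤ g) (hl : 0 < lam) (n : ℕ) : 0 ≤ meanTrace P g lam n := by
  refine mul_nonneg hg (integral_nonneg fun x => ?_)
  simp only [Pi.zero_apply]
  rw [← integral_quad hM hmean]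
  exact integral_nonneg fun z =>
    quad_nonneg_of_posSemidef (matResolvent_posSemidef (rowGram_posSemidef hg x) hl) _

/-- The deviation splits into the conditional fluctuation of the form, the change of trace on
restoring row `i`, and the fluctuation of the full trace; these give the three summands. With `g` of
order `1/n` and `d ≤ n` the total is of order `ν + 1/n`. -/
theorem integral_quad_sub_meanTrace_sq_le (hM : fourthMoment P ≤ C) (hmean : ∫ x, x ∂P = 0)
    {ν : ℝ} (hν0 : 0 ≤ ν) (hν : quadFormVar P ≤ ENNReal.ofReal ν) {g lam : ℝ}
    (hg : 0 ≤ g) (hl : 0 < lam) {m : ℕ} (i : Fin (m + 1)) :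
    Integrable (fun x : Fin (m + 1) → EuclideanSpace ℝ (Fin d) =>
      (g * ((x i).ofLp ⬝ᵥ rowRes g lam (dropRow i x) *ᵥ (x i).ofLp) -
        meanTrace P g lam (m + 1)) ^ 2) (Measure.pi fun _ => P) ∧
    ∫ x, (g * ((x i).ofLp ⬝ᵥ rowRes g lam (dropRow i x) *ᵥ (x i).ofLp) -
        meanTrace P g lam (m + 1)) ^ 2 ∂(Measure.pi fun _ : Fin (m + 1) => P) ≤
      3 * g ^ 2 * (d ^ 2 * ν * lam⁻¹ ^ 2 + ((1 + C) / lam) ^ 2 +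
        ((m + 1 : ℕ) : ℝ) * ((1 + C) / lam) ^ 2) := by
  have hB := (continuous_rowRes (d := d) hg hl m).comp (continuous_dropRow i)
  simp only [Function.comp_def] at hB
  have hR := continuous_rowRes (d := d) hg hl (m + 1)
  obtain ⟨i1, h1⟩ := integral_quad_dropRow_sub_sq_le hM hmean hν0 hν hg hl i
  have h3 := integral_trace_sub_sq_le hM hmean hg hl (m + 1)
  set M := ∫ x', (covMatrix P * rowRes g lam x').trace ∂(Measure.pi fun _ : Fin (m + 1) => P)
    with hMdef
  have i3 : Integrable (fun x : Fin (m + 1) → EuclideanSpace ℝ (Fin d) =>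
      ((covMatrix P * rowRes g lam x).trace - M) ^ 2) (Measure.pi fun _ => P) := by
    refine integrable_pi_of_bound (by fun_prop) ((d * ((1 + C) * lam⁻¹) + |M|) ^ 2) fun x => ?_
    rw [abs_of_nonneg (sq_nonneg _), ← sq_abs]
    gcongr
    exact (abs_sub _ _).trans
      (by gcongr; exact abs_trace_covMatrix_mul_le hM hmean (norm_rowRes_le hg hl _))
  have hpt : ∀ x : Fin (m + 1) → EuclideanSpace ℝ (Fin d),
      (g * ((x i).ofLp ⬝ᵥ rowRes g lam (dropRow i x) *ᵥ (x i).ofLp) -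
        meanTrace P g lam (m + 1)) ^ 2 ≤
      3 * g ^ 2 * ((((x i).ofLp ⬝ᵥ rowRes g lam (dropRow i x) *ᵥ (x i).ofLp -
        (covMatrix P * rowRes g lam (dropRow i x)).trace) ^ 2 + ((1 + C) / lam) ^ 2) +
        ((covMatrix P * rowRes g lam x).trace - M) ^ 2) := fun x => by
    have h2 := trace_rowRes_sub_mem hg hl i x (covMatrix_posSemidef hM hmean)
      (norm_covMatrix_le hM hmean)
    rw [meanTrace, ← hMdef, ← mul_sub, mul_pow]
    generalize (x i).ofLp ⬝ᵥ rowRes g lam (dropRow i x) *ᵥ (x i).ofLp = q at *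
    generalize (covMatrix P * rowRes g lam (dropRow i x)).trace = t at *
    generalize (covMatrix P * rowRes g lam x).trace = t' at *
    have h4 : (t - t') ^ 2 ≤ ((1 + C) / lam) ^ 2 := by
      have := h2.1
      gcongr
      exact h2.2
    have h5 : (q - M) ^ 2 ≤ 3 * (((q - t) ^ 2 + (t - t') ^ 2) + (t' - M) ^ 2) := by
      nlinarith [sq_nonneg ((q - t) - (t - t')), sq_nonneg ((q - t) - (t' - M)),
        sq_nonneg ((t - t') - (t' - M))]
    calc g ^ 2 * (q - M) ^ 2 ≤ g ^ 2 * (3 * (((q - t) ^ 2 + ((1 + C) / lam) ^ 2) +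
          (t' - M) ^ 2)) := by gcongr; linarith
      _ = _ := by ring
  have i12 := i1.add (integrable_const (((1 + C) / lam : ℝ) ^ 2))
  have idom := ((i12.add i3).const_mul (3 * g ^ 2))
  refine ⟨idom.mono' (by fun_prop) (ae_of_all _ fun x => ?_), ?_⟩
  · rw [Real.norm_of_nonneg (sq_nonneg _)]
    exact hpt x
  · refine (integral_mono_of_nonneg (ae_of_all _ fun x => sq_nonneg _) idom
      (ae_of_all _ hpt)).trans ?_
    rw [integral_const_mul]
    gcongr
    refine (integral_add i12 i3).trans_le ?_
    gcongr
    refine (integral_add i1 (integrable_const _)).trans_le ?_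
    simpa using h1

/-- Weighted Young inequality in place of Hölder: `p`, `q`, `p'` have only bounded fourth moments,
while `r` has a small second moment. The weight `τ` is meant to be the size of `r` in L². -/
theorem young_quartic_le {p q r p' τ g : ℝ} (hτ : 0 < τ) (hg : 0 ≤ g) :
    |p| * |q| * |r| + g * |p| * |p'| ≤
      (((τ + g) * p ^ 4 + τ * q ^ 4) + g * p' ^ 4) + (2 * τ⁻¹ * r ^ 2 + 2 * g) := by
  rw [← Even.pow_abs (by decide : Even 4) p, ← Even.pow_abs (by decide : Even 4) q,
    ← Even.pow_abs (by decide : Even 4) p', ← sq_abs r]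
  have hP := abs_nonneg p
  have hQ := abs_nonneg q
  have hP' := abs_nonneg p'
  generalize |p| = p at *
  generalize |q| = q at *
  generalize |p'| = p' at *
  generalize |r| = r at *
  have k1 : p * q * r ≤ τ * (p ^ 4 + q ^ 4) + 2 * τ⁻¹ * r ^ 2 := by
    -- Completing this square trades the triple product for `τ⁻¹ r²` and `τ (pq)²`.
    have : 0 ≤ τ⁻¹ * (r - τ * (p * q)) ^ 2 := by positivity
    have e : τ⁻¹ * (r - τ * (p * q)) ^ 2 = τ⁻¹ * r ^ 2 - 2 * (p * q * r) + τ * (p * q) ^ 2 := by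
      field_simp
      ring
    have k2 : τ * (p * q) ^ 2 ≤ τ * ((p ^ 4 + q ^ 4) / 2) := by
      gcongr; nlinarith [sq_nonneg (p ^ 2 - q ^ 2)]
    have k3 : 0 ≤ τ⁻¹ * r ^ 2 := by positivity
    have k4 : 0 ≤ τ * (p ^ 4 + q ^ 4) := by positivity
    linarith
  have k2 : g * p * p' ≤ g * (p ^ 4 + p' ^ 4 + 2) := by
    rw [mul_assoc]
    gcongr
    nlinarith [sq_nonneg (p - p'), sq_nonneg (p ^ 2 - 1), sq_nonneg (p' ^ 2 - 1)]
  linarith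

/-- Integrated form of a pointwise decoupling bound. -/
theorem abs_integral_sub_le_of_decouple {T : Type*} [MeasurableSpace T] {π : Measure T}
    [IsProbabilityMeasure π] {A U A' U' p q r p' : T → ℝ} {κ τ g K1 K2 K3 : ℝ} (hτ : 0 < τ)
    (hg : 0 ≤ g)
    (iA : Integrable A π) (iU : Integrable U π) (iA' : Integrable A' π) (iU' : Integrable U' π)
    (hzero : ∫ x, (A' x - U' x) ∂π = 0)
    (hpt : ∀ x, |A x - κ * U x - κ * (A' x - U' x)| ≤ |p x| * |q x| * |r x| + g * |p x| * |p' x|)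
    (ip : Integrable (fun x => p x ^ 4) π) (hp : ∫ x, p x ^ 4 ∂π ≤ K1)
    (iq : Integrable (fun x => q x ^ 4) π) (hq : ∫ x, q x ^ 4 ∂π ≤ K2)
    (ip' : Integrable (fun x => p' x ^ 4) π) (hp' : ∫ x, p' x ^ 4 ∂π ≤ K3)
    (ir : Integrable (fun x => r x ^ 2) π) (hr : ∫ x, r x ^ 2 ∂π ≤ τ ^ 2) :
    |∫ x, A x ∂π - κ * ∫ x, U x ∂π| ≤ τ * (K1 + K2 + 2) + g * (2 + K1 + K3) := by
  have e : ∫ x, A x ∂π - κ * ∫ x, U x ∂π = ∫ x, (A x - κ * U x - κ * (A' x - U' x)) ∂π := by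
    have j1 : Integrable (fun x => A x - κ * U x) π := iA.sub (iU.const_mul _)
    have j2 : Integrable (fun x => A' x - U' x) π := iA'.sub iU'
    rw [integral_sub j1 (j2.const_mul _), integral_sub iA (iU.const_mul _), integral_const_mul,
      integral_const_mul, hzero]
    ring
  have j1 : Integrable (fun x => (τ + g) * p x ^ 4 + τ * q x ^ 4) π :=
    (ip.const_mul _).add (iq.const_mul _)
  have j2 : Integrable (fun x => ((τ + g) * p x ^ 4 + τ * q x ^ 4) + g * p' x ^ 4) π :=
    j1.add (ip'.const_mul _)
  have j3 : Integrable (fun x => 2 * τ⁻¹ * r x ^ 2 + 2 * g) π :=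
    (ir.const_mul _).add (integrable_const _)
  rw [e]
  refine abs_integral_le_integral_abs.trans ((integral_mono_of_nonneg
    (ae_of_all _ fun x => abs_nonneg _) (j2.add j3)
    (ae_of_all _ fun x => (hpt x).trans (young_quartic_le hτ hg))).trans ?_)
  refine (integral_add j2 j3).trans_le ?_
  rw [integral_add j1 (ip'.const_mul _), integral_add (ip.const_mul _) (iq.const_mul _),
    integral_add (ir.const_mul _) (integrable_const _)]
  simp only [integral_const_mul, integral_const, probReal_univ, smul_eq_mul, one_mul]
  -- Here the weight pays off: `E r² ≤ τ²` makes this term, too, of order `τ`.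
  have h1 : τ⁻¹ * ∫ x, r x ^ 2 ∂π ≤ τ := by
    rw [inv_mul_le_iff₀ hτ, ← sq]
    exact hr
  have h2 : (τ + g) * ∫ x, p x ^ 4 ∂π ≤ (τ + g) * K1 := by gcongr
  have h3 : τ * ∫ x, q x ^ 4 ∂π ≤ τ * K2 := by gcongr
  have h4 : g * ∫ x, p' x ^ 4 ∂π ≤ g * K3 := by gcongr
  linarith

/-- The decoupling estimate for one row. -/
theorem abs_integral_decouple_le (hM : fourthMoment P ≤ C) (hmean : ∫ x, x ∂P = 0)
    {ν : ℝ} (hν0 : 0 ≤ ν) (hν : quadFormVar P ≤ ENNReal.ofReal ν) {g lam τ : ℝ}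
    (hg : 0 ≤ g) (hl : 0 < lam) (hτ : 0 < τ) {m : ℕ} (i : Fin (m + 1))
    (hρ : 3 * g ^ 2 * (d ^ 2 * ν * lam⁻¹ ^ 2 + ((1 + C) / lam) ^ 2 +
        ((m + 1 : ℕ) : ℝ) * ((1 + C) / lam) ^ 2) ≤ τ ^ 2)
    {u v : Fin d → ℝ} (hu : eNorm u = 1) (hv : eNorm v = 1) :
    Integrable (fun x : Fin (m + 1) → EuclideanSpace ℝ (Fin d) =>
      (u ⬝ᵥ rowRes g lam x *ᵥ (x i).ofLp) * (v ⬝ᵥ (x i).ofLp)) (Measure.pi fun _ => P) ∧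
    |∫ x, (u ⬝ᵥ rowRes g lam x *ᵥ (x i).ofLp) * (v ⬝ᵥ (x i).ofLp)
        ∂(Measure.pi fun _ : Fin (m + 1) => P) -
      (1 + meanTrace P g lam (m + 1))⁻¹ * ∫ x, u ⬝ᵥ rowRes g lam x *ᵥ (covMatrix P *ᵥ v)
        ∂(Measure.pi fun _ : Fin (m + 1) => P)| ≤
      τ * (C * lam⁻¹ ^ 4 + C + 2) + g * (2 + C * lam⁻¹ ^ 4 + C * (lam⁻¹ * (1 + C)) ^ 4) := by
  have hB0 := continuous_rowRes (d := d) hg hl m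
  have hB := hB0.comp (continuous_dropRow i)
  simp only [Function.comp_def] at hB
  have hR := continuous_rowRes (d := d) hg hl (m + 1)
  set a := meanTrace P g lam (m + 1) with ha
  have ha0 : 0 ≤ a := meanTrace_nonneg hM hmean hg hl _
  set t := covMatrix P *ᵥ v with ht
  have htn : eNorm t ≤ 1 + C := by
    refine (eNorm_mulVec_le _ _).trans ?_
    rw [hv, mul_one]; exact norm_covMatrix_le hM hmean
  set π := Measure.pi fun _ : Fin (m + 1) => P
  have hyb : ∀ (y : Fin d → ℝ) (r : ℝ), eNorm y ≤ r → ∀ w : Fin m → EuclideanSpace ℝ (Fin d),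
      eNorm (rowRes g lam w *ᵥ y) ≤ lam⁻¹ * r := fun y r hy w =>
    (eNorm_mulVec_le _ _).trans (mul_le_mul (norm_rowRes_le hg hl w) hy (eNorm_nonneg _)
      (inv_nonneg.2 hl.le))
  have hsym : ∀ (y : Fin d → ℝ) (w : Fin m → EuclideanSpace ℝ (Fin d)) (z : Fin d → ℝ),
      y ⬝ᵥ rowRes g lam w *ᵥ z = (rowRes g lam w *ᵥ y) ⬝ᵥ z := fun y w z =>
    dotProduct_matResolvent_mulVec (rowGram_posSemidef hg w) hl y z
  obtain ⟨ip4, hp4⟩ := integral_dot_dropRow_pow_four_le hM i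
    (y := fun w => rowRes g lam w *ᵥ u) (by fun_prop) (hyb u 1 hu.le)
  obtain ⟨iq4, hq4⟩ := integral_dot_dropRow_pow_four_le hM i (y := fun _ => v) (by fun_prop)
    (r := 1) (fun _ => hv.le)
  obtain ⟨ip4', hp4'⟩ := integral_dot_dropRow_pow_four_le hM i
    (y := fun w => rowRes g lam w *ᵥ t) (by fun_prop) (hyb t _ htn)
  obtain ⟨ir, hr⟩ := integral_quad_sub_meanTrace_sq_le hM hmean hν0 hν hg hl i
  rw [← ha] at ir hr
  have quadr : ∀ r : ℝ, r ^ 2 ≤ 1 * (1 + r ^ 4) := fun r => by nlinarith [sq_nonneg (r ^ 2 - 1)]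
  have hmul : ∀ (A : Matrix (Fin d) (Fin d) ℝ) (z : EuclideanSpace ℝ (Fin d)), ‖A‖ ≤ lam⁻¹ →
      |(u ⬝ᵥ A *ᵥ z.ofLp) * (v ⬝ᵥ z.ofLp)| ≤ lam⁻¹ * (1 + ‖z‖ ^ 4) := fun A z hA => by
    have hl' := inv_pos.2 hl
    rw [abs_mul]
    have e1 := abs_bilin_le A u z.ofLp
    have e2 := abs_dotProduct_le v z.ofLp
    rw [hu, eNorm_ofLp, mul_one] at e1
    rw [hv, eNorm_ofLp, one_mul] at e2
    calc _ ≤ (lam⁻¹ * ‖z‖) * ‖z‖ := by gcongr; exact e1.trans (by gcongr)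
      _ = lam⁻¹ * ‖z‖ ^ 2 := by ring
      _ ≤ _ := by gcongr; simpa using quadr ‖z‖
  have iA : Integrable (fun x : Fin (m + 1) → EuclideanSpace ℝ (Fin d) =>
      (u ⬝ᵥ rowRes g lam x *ᵥ (x i).ofLp) * (v ⬝ᵥ (x i).ofLp)) π :=
    integrable_pi_of_quartic hM i (by fun_prop) lam⁻¹ fun x =>
      hmul _ _ (norm_rowRes_le hg hl x)
  have iA' : Integrable (fun x : Fin (m + 1) → EuclideanSpace ℝ (Fin d) =>
      (u ⬝ᵥ rowRes g lam (dropRow i x) *ᵥ (x i).ofLp) * (v ⬝ᵥ (x i).ofLp)) π :=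
    integrable_pi_of_quartic hM i (by fun_prop) lam⁻¹ fun x =>
      hmul _ _ (norm_rowRes_le hg hl _)
  have hbt : ∀ A : Matrix (Fin d) (Fin d) ℝ, ‖A‖ ≤ lam⁻¹ → |u ⬝ᵥ A *ᵥ t| ≤ lam⁻¹ * (1 + C) :=
    fun A hA => by
      refine (abs_bilin_le A u t).trans ?_
      rw [hu, mul_one]
      exact mul_le_mul hA htn (eNorm_nonneg _) (inv_nonneg.2 hl.le)
  have iT : Integrable (fun x : Fin (m + 1) → EuclideanSpace ℝ (Fin d) =>
      u ⬝ᵥ rowRes g lam x *ᵥ t) π :=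
    integrable_pi_of_bound (by fun_prop) _ fun x => hbt _ (norm_rowRes_le hg hl x)
  have iT' : Integrable (fun x : Fin (m + 1) → EuclideanSpace ℝ (Fin d) =>
      u ⬝ᵥ rowRes g lam (dropRow i x) *ᵥ t) π :=
    integrable_pi_of_bound (by fun_prop) _ fun x => hbt _ (norm_rowRes_le hg hl _)
  refine ⟨iA, ?_⟩
  -- Integrating over row `i` first, with the others frozen, `x_i x_iᵀ` averages to `Σ`; the
  -- decoupled main term is therefore exactly centered.
  have hzero : ∫ x, ((u ⬝ᵥ rowRes g lam (dropRow i x) *ᵥ (x i).ofLp) * (v ⬝ᵥ (x i).ofLp) -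
      u ⬝ᵥ rowRes g lam (dropRow i x) *ᵥ t) ∂π = 0 := by
    have j : Integrable (fun x : Fin (m + 1) → EuclideanSpace ℝ (Fin d) =>
      (u ⬝ᵥ rowRes g lam (dropRow i x) *ᵥ (x i).ofLp) * (v ⬝ᵥ (x i).ofLp) -
        u ⬝ᵥ rowRes g lam (dropRow i x) *ᵥ t) π := iA'.sub iT'
    rw [integral_pi_insertNth i j]
    refine integral_eq_zero_of_ae (ae_of_all _ fun w => ?_)
    simp only [dropRow_insertNth, Fin.insertNth_apply_same, Pi.zero_apply, hsym]
    rw [integral_sub (integrable_dot_mul_dot hM _ _) (integrable_const _),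
      integral_dot_mul_dot hM hmean, ← ht]
    simp
  have hpt : ∀ x : Fin (m + 1) → EuclideanSpace ℝ (Fin d),
      |(u ⬝ᵥ rowRes g lam x *ᵥ (x i).ofLp) * (v ⬝ᵥ (x i).ofLp) -
        (1 + a)⁻¹ * (u ⬝ᵥ rowRes g lam x *ᵥ t) -
        (1 + a)⁻¹ * ((u ⬝ᵥ rowRes g lam (dropRow i x) *ᵥ (x i).ofLp) * (v ⬝ᵥ (x i).ofLp) -
          u ⬝ᵥ rowRes g lam (dropRow i x) *ᵥ t)| ≤
      |(rowRes g lam (dropRow i x) *ᵥ u) ⬝ᵥ (x i).ofLp| * |v ⬝ᵥ (x i).ofLp| *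
        |g * ((x i).ofLp ⬝ᵥ rowRes g lam (dropRow i x) *ᵥ (x i).ofLp) - a| +
      g * |(rowRes g lam (dropRow i x) *ᵥ u) ⬝ᵥ (x i).ofLp| *
        |(rowRes g lam (dropRow i x) *ᵥ t) ⬝ᵥ (x i).ofLp| := fun x => by
    have h := abs_decouple_le (rowGram_posSemidef hg (dropRow i x)) hl hg ha0 (x i).ofLp u v t
    rw [← rowGram_eq_dropRow, dotProduct_comm (x i).ofLp (_ *ᵥ t)] at h
    have hs := hsym u (dropRow i x) (x i).ofLp
    unfold rowRes at hs ⊢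
    rw [← hs]
    exact h
  have hfin := abs_integral_sub_le_of_decouple hτ hg iA iT iA' iT' hzero hpt ip4 hp4 iq4 hq4 ip4'
    hp4' ir (hr.trans hρ)
  rw [mul_one, one_pow, mul_one] at hfin
  exact hfin

end Decoupling

/-! ### Entrywise expectation against bilinear forms and traces -/

section Expectation

variable {d : ℕ} {Ω : Type*} [MeasurableSpace Ω] {μ : Measure Ω}
  {A : Ω → Matrix (Fin d) (Fin d) ℝ}

theorem integral_sum_mul_entries (hA : MatIntegrable A μ) (q : Fin d → Fin d → ℝ) :
    ∫ ω, ∑ i, ∑ j, q i j * A ω i j ∂μ = ∑ i, ∑ j, q i j * matExpect A μ i j := by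
  rw [integral_finsetSum _ fun i _ => integrable_finsetSum _ fun j _ => (hA i j).const_mul _]
  refine Finset.sum_congr rfl fun i _ => ?_
  rw [integral_finsetSum _ fun j _ => (hA i j).const_mul _]
  exact Finset.sum_congr rfl fun j _ => integral_const_mul _ _

theorem dotProduct_mulVec_eq_sum (B : Matrix (Fin d) (Fin d) ℝ) (u v : Fin d → ℝ) :
    u ⬝ᵥ B *ᵥ v = ∑ i, ∑ j, (u i * v j) * B i j := by
  simp only [dotProduct, Matrix.mulVec, Finset.mul_sum]
  exact Finset.sum_congr rfl fun i _ => Finset.sum_congr rfl fun j _ => by ring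

theorem trace_mul_eq_sum (S B : Matrix (Fin d) (Fin d) ℝ) :
    (S * B).trace = ∑ i, ∑ j, S j i * B i j := by
  rw [Finset.sum_comm]
  simp [Matrix.trace, Matrix.mul_apply]

theorem dotProduct_matExpect_mulVec (hA : MatIntegrable A μ) (u v : Fin d → ℝ) :
    u ⬝ᵥ matExpect A μ *ᵥ v = ∫ ω, u ⬝ᵥ A ω *ᵥ v ∂μ := by
  simp_rw [dotProduct_mulVec_eq_sum]
  exact (integral_sum_mul_entries hA fun i j => u i * v j).symm

theorem trace_mul_matExpect (hA : MatIntegrable A μ) (S : Matrix (Fin d) (Fin d) ℝ) :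
    (S * matExpect A μ).trace = ∫ ω, (S * A ω).trace ∂μ := by
  simp_rw [trace_mul_eq_sum]
  exact (integral_sum_mul_entries hA fun i j => S j i).symm

end Expectation

/-! ### The approximate inverse equation and the quantitative bound -/

section Core

variable {d : ℕ} {P : Measure (EuclideanSpace ℝ (Fin d))} [IsProbabilityMeasure P] {C : ℝ≥0}

theorem matIntegrable_rowRes {g lam : ℝ} (hg : 0 ≤ g) (hl : 0 < lam) (n : ℕ) :
    MatIntegrable (fun x : Fin n → EuclideanSpace ℝ (Fin d) => rowRes g lam x)
      (Measure.pi fun _ => P) := fun i j =>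
  integrable_pi_of_bound ((continuous_rowRes hg hl n).matrix_elem i j) lam⁻¹ fun x =>
    (abs_entry_le_norm _ i j).trans (norm_rowRes_le hg hl x)

/-- The expected resolvent approximately inverts `b Σ + λ`. -/
theorem norm_matExpect_mul_sub_one_le {g lam ε : ℝ} (hg : 0 ≤ g) (hl : 0 < lam) {n : ℕ} (hε0 : 0 ≤ ε)
    (hε : ∀ (i : Fin n) (u v : Fin d → ℝ), eNorm u = 1 → eNorm v = 1 →
      Integrable (fun x : Fin n → EuclideanSpace ℝ (Fin d) =>
        (u ⬝ᵥ rowRes g lam x *ᵥ (x i).ofLp) * (v ⬝ᵥ (x i).ofLp)) (Measure.pi fun _ => P) ∧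
      |∫ x, (u ⬝ᵥ rowRes g lam x *ᵥ (x i).ofLp) * (v ⬝ᵥ (x i).ofLp)
          ∂(Measure.pi fun _ : Fin n => P) -
        (1 + meanTrace P g lam n)⁻¹ * ∫ x, u ⬝ᵥ rowRes g lam x *ᵥ (covMatrix P *ᵥ v)
          ∂(Measure.pi fun _ : Fin n => P)| ≤ ε) :
    ‖matExpect (fun x : Fin n → EuclideanSpace ℝ (Fin d) => rowRes g lam x)
        (Measure.pi fun _ => P) *
      ((g * n * (1 + meanTrace P g lam n)⁻¹) • covMatrix P +
        lam • (1 : Matrix (Fin d) (Fin d) ℝ)) - 1‖ ≤ g * n * ε := by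
  set π := Measure.pi fun _ : Fin n => P
  have hR := matIntegrable_rowRes (P := P) (d := d) hg hl n
  refine norm_le_of_abs_bilin_unit_le (by positivity) fun u v hu hv => ?_
  set κ := (1 + meanTrace P g lam n)⁻¹
  set I := ∫ x, u ⬝ᵥ rowRes g lam x *ᵥ (covMatrix P *ᵥ v) ∂π with hI
  set J : Fin n → ℝ := fun i => ∫ x, (u ⬝ᵥ rowRes g lam x *ᵥ (x i).ofLp) * (v ⬝ᵥ (x i).ofLp) ∂π
    with hJ
  have hi := fun i => (hε i u v hu hv).1
  -- The expectation of `u · R (g ∑ x_i x_iᵀ + λ) v = u · v`, one term per row.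
  have hone : u ⬝ᵥ v = lam * ∫ x, u ⬝ᵥ rowRes g lam x *ᵥ v ∂π + g * ∑ i, J i := by
    have hpt : ∀ x : Fin n → EuclideanSpace ℝ (Fin d), u ⬝ᵥ v =
        lam * (u ⬝ᵥ rowRes g lam x *ᵥ v) +
          g * ∑ i, (u ⬝ᵥ rowRes g lam x *ᵥ (x i).ofLp) * (v ⬝ᵥ (x i).ofLp) := fun x => by
      have h1 : rowRes g lam x * (rowGram g x + lam • 1) = 1 :=
        matResolvent_mul_add (rowGram_posSemidef hg x) hl
      have h2 : u ⬝ᵥ (rowRes g lam x * (rowGram g x + lam • 1)) *ᵥ v = u ⬝ᵥ v := by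
        rw [h1, Matrix.one_mulVec]
      rw [← h2, mul_add, Matrix.add_mulVec, dotProduct_add, rowGram, mul_smul_comm, mul_smul_comm,
        mul_one, Matrix.smul_mulVec, Matrix.smul_mulVec, dotProduct_smul, dotProduct_smul,
        Matrix.mul_sum, Matrix.sum_mulVec, dotProduct_sum, smul_eq_mul, smul_eq_mul, add_comm]
      congr 2
      refine Finset.sum_congr rfl fun i _ => ?_
      rw [Matrix.mul_vecMulVec, Matrix.vecMulVec_mulVec, op_smul_eq_smul, dotProduct_smul,
        smul_eq_mul, mul_comm, dotProduct_comm (x i).ofLp v]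
    have iv : Integrable (fun x => u ⬝ᵥ rowRes g lam x *ᵥ v) π := by
      have hc := continuous_rowRes (d := d) hg hl n
      refine integrable_pi_of_bound (by fun_prop) lam⁻¹ fun x => (abs_bilin_le _ u v).trans ?_
      rw [hu, hv, mul_one, mul_one]
      exact norm_rowRes_le hg hl x
    calc u ⬝ᵥ v = ∫ _ : Fin n → EuclideanSpace ℝ (Fin d), u ⬝ᵥ v ∂π := by simp
      _ = ∫ x, (lam * (u ⬝ᵥ rowRes g lam x *ᵥ v) +
          g * ∑ i, (u ⬝ᵥ rowRes g lam x *ᵥ (x i).ofLp) * (v ⬝ᵥ (x i).ofLp)) ∂π :=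
          integral_congr_ae (ae_of_all _ hpt)
      _ = _ := by
          rw [integral_add (iv.const_mul _)
              ((integrable_finsetSum _ fun i _ => hi i).const_mul _),
            integral_const_mul, integral_const_mul, integral_finsetSum _ fun i _ => hi i]
  have e : u ⬝ᵥ (matExpect (fun x : Fin n → EuclideanSpace ℝ (Fin d) => rowRes g lam x) π *
      ((g * n * κ) • covMatrix P + lam • (1 : Matrix (Fin d) (Fin d) ℝ)) - 1) *ᵥ v =
      -(g * ∑ i, (J i - κ * I)) := by
    rw [Matrix.sub_mulVec, dotProduct_sub, Matrix.one_mulVec, hone, mul_add, Matrix.add_mulVec,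
      dotProduct_add, mul_smul_comm, mul_smul_comm, mul_one, Matrix.smul_mulVec,
      Matrix.smul_mulVec, dotProduct_smul, dotProduct_smul, ← Matrix.mulVec_mulVec,
      dotProduct_matExpect_mulVec hR, dotProduct_matExpect_mulVec hR, ← hI,
      Finset.sum_sub_distrib, smul_eq_mul, smul_eq_mul]
    simp only [Finset.sum_const, Finset.card_univ, Fintype.card_fin, nsmul_eq_mul]
    ring
  rw [e, abs_neg, abs_mul, abs_of_nonneg hg, mul_assoc]
  gcongr
  refine (Finset.abs_sum_le_sum_abs _ _).trans
    ((Finset.sum_le_sum fun i _ => (hε i u v hu hv).2).trans ?_)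
  simp

theorem norm_sub_matResolvent_le {A W : Matrix (Fin d) (Fin d) ℝ} {lam δ : ℝ}
    (hW : W.PosSemidef) (hl : 0 < lam)
    (h : ‖A * (W + lam • (1 : Matrix (Fin d) (Fin d) ℝ)) - 1‖ ≤ δ) :
    ‖A - matResolvent W lam‖ ≤ δ * lam⁻¹ := by
  have e : A - matResolvent W lam =
      (A * (W + lam • (1 : Matrix (Fin d) (Fin d) ℝ)) - 1) * matResolvent W lam := by
    rw [sub_mul, mul_assoc, add_mul_matResolvent hW hl, mul_one, one_mul]
  rw [e]
  exact (norm_mul_le _ _).trans (mul_le_mul h (norm_matResolvent_le hW hl) (norm_nonneg _)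
    ((norm_nonneg _).trans h))

/-- Removing the scalar `b`, by the fixed point equation. -/
theorem norm_matExpect_sub_matResolvent_le (hM : fourthMoment P ≤ C) (hmean : ∫ x, x ∂P = 0)
    {g lam c δ : ℝ} (hg : 0 ≤ g) (hl : 0 < lam) {n : ℕ} (hcn : c = g * n)
    (hc : c = 1 + g * effDim (covMatrix P) lam) (hdn : d ≤ n)
    (h : ‖matExpect (fun x : Fin n → EuclideanSpace ℝ (Fin d) => rowRes g lam x)
        (Measure.pi fun _ => P) *
      ((g * n * (1 + meanTrace P g lam n)⁻¹) • covMatrix P +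
        lam • (1 : Matrix (Fin d) (Fin d) ℝ)) - 1‖ ≤ δ) :
    ‖matExpect (fun x : Fin n → EuclideanSpace ℝ (Fin d) => rowRes g lam x)
        (Measure.pi fun _ => P) - matResolvent (covMatrix P) lam‖ ≤
      δ * (lam⁻¹ * (1 + c ^ 2 * (1 + C) ^ 2 / lam ^ 2)) := by
  have hS := covMatrix_posSemidef hM hmean
  have hs := norm_covMatrix_le hM hmean
  have ha0 := meanTrace_nonneg hM hmean hg hl n
  have hR := matIntegrable_rowRes (P := P) (d := d) hg hl n
  have ha : meanTrace P g lam n = g * (covMatrix P * matExpect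
      (fun x : Fin n → EuclideanSpace ℝ (Fin d) => rowRes g lam x) (Measure.pi fun _ => P)).trace :=
    by rw [meanTrace, trace_mul_matExpect hR]
  set A := matExpect (fun x : Fin n → EuclideanSpace ℝ (Fin d) => rowRes g lam x)
    (Measure.pi fun _ => P)
  set S := covMatrix P
  set a := meanTrace P g lam n
  set b := g * n * (1 + a)⁻¹ with hb
  have hc0 : 0 ≤ c := by rw [hcn]; positivity
  have hb0 : 0 ≤ b := by positivity
  have hbc : b ≤ c := by
    rw [hb, ← hcn]
    exact mul_le_of_le_one_right hc0 (inv_le_one_of_one_le₀ (by linarith))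
  have hbe : c = b * (1 + a) := by
    rw [hb, ← hcn, mul_assoc, inv_mul_cancel₀ (by linarith), mul_one]
  have h1 := norm_sub_matResolvent_le (hS.smul hb0) hl h
  have hδ : 0 ≤ δ := (norm_nonneg _).trans h
  have hdiff : |(S * (A - matResolvent (b • S) lam)).trace| ≤ d * ((1 + C) * (δ * lam⁻¹)) := by
    refine (abs_trace_le _).trans ?_
    gcongr
    exact (norm_mul_le _ _).trans (mul_le_mul hs h1 (norm_nonneg _) (by positivity))
  -- The trace estimate loses a factor `d`; this is where `d ≤ n` absorbs it.
  have hgd : g * d ≤ c := by rw [hcn]; gcongr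
  have h2 : |b - 1| ≤ c ^ 2 * ((1 + C) * (δ * lam⁻¹)) := by
    refine abs_sub_one_le_of_fixedPoint hS hl hb0 hg hc ?_
    -- Since `c = b (1 + a)` holds exactly, the only defect in the fixed point equation is that `a`
    -- involves `E[R]` instead of the resolvent of `b Σ`.
    have e : c - (b + g * (b * (S * matResolvent (b • S) lam).trace)) =
        b * g * (S * (A - matResolvent (b • S) lam)).trace := by
      rw [mul_sub, Matrix.trace_sub]
      nth_rw 1 [hbe]
      rw [ha]
      ring
    rw [e, abs_mul, abs_of_nonneg (by positivity)]
    calc b * g * |(S * (A - matResolvent (b • S) lam)).trace|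
        ≤ b * g * (d * ((1 + C) * (δ * lam⁻¹))) := by gcongr
      _ = b * (g * d) * ((1 + C) * (δ * lam⁻¹)) := by ring
      _ ≤ c * c * ((1 + C) * (δ * lam⁻¹)) := by gcongr
      _ = _ := by ring
  have h3 := norm_matResolvent_sub_le hS hl hb0 hs
  calc ‖A - matResolvent S lam‖
      = ‖(A - matResolvent (b • S) lam) - (matResolvent S lam - matResolvent (b • S) lam)‖ := by
        congr 1; abel
    _ ≤ δ * lam⁻¹ + c ^ 2 * ((1 + C) * (δ * lam⁻¹)) * ((1 + C) / lam ^ 2) := by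
        refine (norm_sub_le _ _).trans (add_le_add h1 (h3.trans ?_))
        gcongr
    _ = _ := by ring

/-- The quantitative estimate behind the convergence theorem. -/
theorem norm_matExpect_rowRes_sub_le (hM : fourthMoment P ≤ C) (hmean : ∫ x, x ∂P = 0)
    {ν : ℝ} (hν0 : 0 ≤ ν) (hν : quadFormVar P ≤ ENNReal.ofReal ν) {lam c c₀ : ℝ} (hl : 0 < lam)
    {n : ℕ} (hn : 0 < n) (hdn : d ≤ n) (hc0 : 0 ≤ c) (hcc : c ≤ c₀)
    (hc : c = 1 + c / n * effDim (covMatrix P) lam) :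
    ‖matExpect (fun x : Fin n → EuclideanSpace ℝ (Fin d) => rowRes (c / n) lam x)
        (Measure.pi fun _ => P) - matResolvent (covMatrix P) lam‖ ≤
      c₀ * (√(3 * c₀ ^ 2 * (ν + 2 * (1 + C) ^ 2 / n) / lam ^ 2) * (C * lam⁻¹ ^ 4 + C + 2) +
        c₀ / n * (2 + C * lam⁻¹ ^ 4 + C * (lam⁻¹ * (1 + C)) ^ 4)) *
      (lam⁻¹ * (1 + c₀ ^ 2 * (1 + C) ^ 2 / lam ^ 2)) := by
  have hnr : (0 : ℝ) < n := by exact_mod_cast hn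
  have hn1 : (1 : ℝ) ≤ n := by exact_mod_cast hn
  have hcpos : 0 < c := by
    rcases hc0.eq_or_lt with h | h
    · rw [← h] at hc; simp at hc
    · exact h
  have hc00 : 0 < c₀ := hcpos.trans_le hcc
  have hg : 0 ≤ c / n := by positivity
  have hcn : c = c / n * n := by field_simp
  set τ := √(3 * c₀ ^ 2 * (ν + 2 * (1 + C) ^ 2 / n) / lam ^ 2) with hτdef
  -- Strict even when `ν = 0`, thanks to the `1/n` term.
  have hτ : 0 < τ := Real.sqrt_pos.2 (by positivity)
  have hρ : 3 * (c / n) ^ 2 * (d ^ 2 * ν * lam⁻¹ ^ 2 + ((1 + C) / lam) ^ 2 +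
        (n : ℝ) * ((1 + C) / lam) ^ 2) ≤ τ ^ 2 := by
    rw [hτdef, Real.sq_sqrt (by positivity)]
    have hd : (d : ℝ) ≤ n := by exact_mod_cast hdn
    calc 3 * (c / n) ^ 2 * (d ^ 2 * ν * lam⁻¹ ^ 2 + ((1 + C) / lam) ^ 2 +
          (n : ℝ) * ((1 + C) / lam) ^ 2)
        ≤ 3 * (c₀ / n) ^ 2 * (n ^ 2 * ν * lam⁻¹ ^ 2 + n * ((1 + C) / lam) ^ 2 +
          (n : ℝ) * ((1 + C) / lam) ^ 2) := by
          gcongr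
          -- The O(1) term is enlarged by a factor `n` to merge with the last one, whence the
          -- constant `2 (1 + C)²/n` in `τ`.
          exact le_mul_of_one_le_left (by positivity) hn1
      _ = _ := by field_simp; ring
  set ε := τ * (C * lam⁻¹ ^ 4 + C + 2) +
    c / n * (2 + C * lam⁻¹ ^ 4 + C * (lam⁻¹ * (1 + C)) ^ 4) with hε
  have hε0 : 0 ≤ ε := by positivity
  have key := norm_matExpect_mul_sub_one_le (P := P) hg hl (n := n) hε0
    fun i u v hu hv => by
      obtain ⟨m, rfl⟩ : ∃ m, n = m + 1 := ⟨n - 1, by omega⟩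
      exact abs_integral_decouple_le hM hmean hν0 hν hg hl hτ i hρ hu hv
  refine (norm_matExpect_sub_matResolvent_le hM hmean hg hl hcn hc hdn key).trans ?_
  rw [← hcn]
  have hεle : ε ≤ τ * (C * lam⁻¹ ^ 4 + C + 2) +
      c₀ / n * (2 + C * lam⁻¹ ^ 4 + C * (lam⁻¹ * (1 + C)) ^ 4) := by
    rw [hε]; gcongr
  gcongr

end Core

/-! ### From i.i.d. samples to the product measure -/

section Transfer

variable {d n : ℕ} {P : Measure (EuclideanSpace ℝ (Fin d))}
  {Ω : Type*} [MeasurableSpace Ω] {μ : Measure Ω} [IsProbabilityMeasure μ]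
  {X : Fin n → Ω → EuclideanSpace ℝ (Fin d)}

theorem map_eq_pi_of_iid (hlaw : ∀ i, HasLaw (X i) P μ) (hindep : iIndepFun X μ) :
    μ.map (fun ω i => X i ω) = Measure.pi fun _ => P := by
  rw [(iIndepFun_iff_map_fun_eq_pi_map fun i => (hlaw i).aemeasurable).1 hindep]
  simp_rw [fun i => (hlaw i).map_eq]

theorem shrinkageEstimator_eq_rowRes (S : Matrix (Fin d) (Fin d) ℝ) (lam : ℝ)
    (x : Fin n → EuclideanSpace ℝ (Fin d)) :
    shrinkageEstimator S lam x = rowRes (1 / (1 - effDim S lam / n) / n) lam x := by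
  rw [shrinkageEstimator, rowRes, empCov, rowGram, smul_smul, ← div_eq_mul_inv]

variable [IsProbabilityMeasure P]

theorem matIntegrable_comp_of_iid (hlaw : ∀ i, HasLaw (X i) P μ) (hindep : iIndepFun X μ)
    {g lam : ℝ} (hg : 0 ≤ g) (hl : 0 < lam) :
    MatIntegrable (fun ω => rowRes g lam fun i => X i ω) μ := fun i j => by
  have hX : AEMeasurable (fun ω i => X i ω) μ := aemeasurable_pi_lambda _ fun i =>
    (hlaw i).aemeasurable
  have h := matIntegrable_rowRes (P := P) (d := d) hg hl n i j
  rw [← map_eq_pi_of_iid hlaw hindep] at h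
  exact h.comp_aemeasurable hX

theorem matExpect_comp_of_iid (hlaw : ∀ i, HasLaw (X i) P μ) (hindep : iIndepFun X μ)
    {g lam : ℝ} (hg : 0 ≤ g) (hl : 0 < lam) :
    matExpect (fun ω => rowRes g lam fun i => X i ω) μ =
      matExpect (fun x : Fin n → EuclideanSpace ℝ (Fin d) => rowRes g lam x)
        (Measure.pi fun _ => P) := by
  have hX : AEMeasurable (fun ω i => X i ω) μ := aemeasurable_pi_lambda _ fun i =>
    (hlaw i).aemeasurable
  ext i j
  have h := (matIntegrable_rowRes (P := P) (d := d) hg hl n i j).aestronglyMeasurable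
  rw [← map_eq_pi_of_iid hlaw hindep] at h
  rw [matExpect, matExpect, Matrix.of_apply, Matrix.of_apply, ← map_eq_pi_of_iid hlaw hindep,
    integral_map hX h]

end Transfer

end CovResolvent

/-! ### Passage to the limit -/

open CovResolvent
theorem mainTheorem1
    -- the sequence of problems, indexed by `k`: sample size `n k`, dimension `d k`
    (n d : ℕ → ℕ) (y : ℝ) (hy0 : 0 ≤ y) (hy1 : y < 1)
    (hn : Tendsto n atTop atTop) (hd : Tendsto d atTop atTop)
    (hnd : Tendsto (fun k => (d k : ℝ) / (n k : ℝ)) atTop (𝓝 y))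
    -- `P k` is the law of the centered population vector `x`
    (P : ∀ k, Measure (EuclideanSpace ℝ (Fin (d k)))) [∀ k, IsProbabilityMeasure (P k)]
    (hmean : ∀ k, ∫ x, x ∂(P k) = 0)
    -- i.i.d. samples from `P k`, the rows of the data matrix
    {Ω : ℕ → Type*} [∀ k, MeasurableSpace (Ω k)]
    (μ : ∀ k, Measure (Ω k)) [∀ k, IsProbabilityMeasure (μ k)]
    (X : ∀ k, Fin (n k) → Ω k → EuclideanSpace ℝ (Fin (d k)))
    (hlaw : ∀ k i, HasLaw (X k i) (P k) (μ k))
    (hindep : ∀ k, iIndepFun (X k) (μ k))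
    -- A1: the e.s.d. of the covariance matrices converges at almost every `u ≥ 0`
    (F : ℝ → ℝ)
    (hA1 : ∀ᵐ u : ℝ, 0 ≤ u →
      Tendsto (fun k => esd (covMatrix_isHermitian (P k)) u) atTop (𝓝 (F u)))
    -- A2: `M` stays bounded and `ν → 0`
    (C : ℝ≥0) (hM : ∀ k, fourthMoment (P k) ≤ (C : ℝ≥0∞))
    (hν : Tendsto (fun k => quadFormVar (P k)) atTop (𝓝 0))
    -- A3: the eigenvalues of each covariance matrix lie in `[σmin, σmax]`
    (σmin : ℕ → ℝ) (σmax : ℝ) (hσmin : ∀ k, 0 < σmin k)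
    (hA3 : ∀ k i, (covMatrix_isHermitian (P k)).eigenvalues i ∈ Set.Icc (σmin k) σmax)
    (lam : ℝ) (hlam : 0 < lam)
    (heff : ∀ k, effDim (covMatrix (P k)) lam < (n k : ℝ)) :
    (∀ k, MatIntegrable
      (fun ω => shrinkageEstimator (covMatrix (P k)) lam (fun i => X k i ω)) (μ k)) ∧
    ∃ Ω₀ : ∀ k, Matrix (Fin (d k)) (Fin (d k)) ℝ,
      (∀ k, matExpect
          (fun ω => shrinkageEstimator (covMatrix (P k)) lam (fun i => X k i ω)) (μ k) =
        matResolvent (covMatrix (P k)) lam + Ω₀ k) ∧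
      Tendsto (fun k => ‖Ω₀ k‖) atTop (𝓝 0) := by
  have hS : ∀ k, (covMatrix (P k)).PosSemidef := fun k => covMatrix_posSemidef (hM k) (hmean k)
  set c : ℕ → ℝ := fun k => 1 / (1 - effDim (covMatrix (P k)) lam / n k) with hcdef
  have hden : ∀ k, 0 < 1 - effDim (covMatrix (P k)) lam / n k := fun k => by
    -- If `n k = 0`, division by zero gives the denominator the value one.
    rcases (Nat.cast_nonneg (α := ℝ) (n k)).eq_or_lt with h | h
    · rw [← h]; simp
    · rw [sub_pos, div_lt_one h]; exact heff k
  have hc0 : ∀ k, 0 ≤ c k := fun k => (one_div_pos.2 (hden k)).le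
  have hg : ∀ k, 0 ≤ c k / n k := fun k => div_nonneg (hc0 k) (Nat.cast_nonneg _)
  simp_rw [shrinkageEstimator_eq_rowRes]
  refine ⟨fun k => matIntegrable_comp_of_iid (hlaw k) (hindep k) (hg k) hlam,
    fun k => matExpect (fun x : Fin (n k) → EuclideanSpace ℝ (Fin (d k)) =>
      rowRes (c k / n k) lam x) (Measure.pi fun _ => P k) - matResolvent (covMatrix (P k)) lam,
    fun k => ?_, ?_⟩
  · rw [add_sub_cancel]
    exact matExpect_comp_of_iid (hlaw k) (hindep k) (hg k) hlam
  -- Eventually `d_λ/n ≤ d/n < (1 + y)/2`, so `1 - d_λ/n` exceeds `(1 - y)/2` and `c ≤ c₀`.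
  set c₀ : ℝ := 2 / (1 - y) with hc₀
  have hνr : Tendsto (fun k => (quadFormVar (P k)).toReal) atTop (𝓝 0) := by
    simpa [Function.comp_def] using (ENNReal.tendsto_toReal ENNReal.zero_ne_top).comp hν
  have hnr : Tendsto (fun k => (n k : ℝ)) atTop atTop := tendsto_natCast_atTop_atTop.comp hn
  have hlim : Tendsto (fun k => c₀ * (√(3 * c₀ ^ 2 * ((quadFormVar (P k)).toReal +
        2 * (1 + C) ^ 2 / n k) / lam ^ 2) * (C * lam⁻¹ ^ 4 + C + 2) +
        c₀ / n k * (2 + C * lam⁻¹ ^ 4 + C * (lam⁻¹ * (1 + C)) ^ 4)) *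
      (lam⁻¹ * (1 + c₀ ^ 2 * (1 + C) ^ 2 / lam ^ 2))) atTop (𝓝 0) := by
    have h1 := hνr.add (hnr.const_div_atTop (2 * (1 + (C : ℝ)) ^ 2))
    have h2 := ((h1.const_mul (3 * c₀ ^ 2)).div_const (lam ^ 2)).sqrt
    have h3 := (h2.mul_const (C * lam⁻¹ ^ 4 + C + 2)).add
      ((hnr.const_div_atTop c₀).mul_const (2 + C * lam⁻¹ ^ 4 + C * (lam⁻¹ * (1 + C)) ^ 4))
    simpa using (h3.const_mul c₀).mul_const (lam⁻¹ * (1 + c₀ ^ 2 * (1 + C) ^ 2 / lam ^ 2))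
  refine squeeze_zero' (Eventually.of_forall fun k => norm_nonneg _) ?_ hlim
  -- Only finiteness is needed, so that passing to real values of `ν` loses nothing.
  have hfin : ∀ᶠ k in atTop, quadFormVar (P k) < 1 := hν.eventually_lt_const (by norm_num)
  have hratio : ∀ᶠ k in atTop, (d k : ℝ) / n k < (1 + y) / 2 :=
    hnd.eventually_lt_const (by linarith)
  filter_upwards [hfin, hratio, hn.eventually_ge_atTop 1] with k hk1 hk2 hk3
  have hnk : (0 : ℝ) < n k := by exact_mod_cast hk3
  have hdn : d k ≤ n k := by
    have : (d k : ℝ) / n k ≤ 1 := by linarith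
    rw [div_le_one hnk] at this
    exact_mod_cast this
  refine norm_matExpect_rowRes_sub_le (hM k) (hmean k) ENNReal.toReal_nonneg
    (ENNReal.ofReal_toReal (hk1.trans ENNReal.one_lt_top).ne).ge hlam hk3 hdn (hc0 k) ?_ ?_
  · have h1 : effDim (covMatrix (P k)) lam / n k ≤ (d k : ℝ) / n k := by
      gcongr; exact effDim_le (hS k) hlam
    rw [hcdef, hc₀, div_le_div_iff₀ (hden k) (by linarith)]
    linarith
  · have h := (hden k).ne'
    -- Rearranged, this is `c = 1 + (c/n) d_λ`: the shrinkage factor is chosen so that `b = 1` is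
    -- the fixed point.
    have e : c k * (1 - effDim (covMatrix (P k)) lam / n k) = 1 :=
      one_div_mul_cancel h
    linear_combination e
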